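/- For a positive integer $r$ write $[r]=\{0,\dots,r-1\}$. Let $U$ be a finite set (the universe of keys). A hash class with range $[r]$ is a finite nonempty set of functions $U\to[r]$; "at random" means with the uniform distribution. A hash class $\mathcal F$ with range $[\ell]$ is *two-universal* if $\Pr_{g\in\mathcal F}(g(x)=g(y))\le 2/\ell$ for all distinct $x,y\in U$. A hash class $\mathcal H$ with range $[m]$ is *two-wise independent* if $\Pr_{f\in\mathcal H}(f(x_1)=j_1\wedge f(x_2)=j_2)=1/m^2$ for all distinct $x_1,x_2\in U$ and all $j_1,j_2\in[m]$. Given such $\mathcal F$ and $\mathcal H$ and an integer $c\ge 1$, a random pair $(h_1,h_2)$ from the class $\mathcal Z^{c,2}_{\ell,m}$ is obtained by choosing, independently and uniformly, $f_1,f_2\in\mathcal H$, $g_1,\dots,g_c\in\mathcal F$, and all entries of two tables $z^{(1)},z^{(2)}\in[m]^{\{1,\dots,c\}\times[\ell]}$, and setting $$h_i(x)=\Bigl(f_i(x)+\sum_{j=1}^{c}z^{(i)}[j,g_j(x)]\Bigr)\bmod m\qquad(x\in U,\ i=1,2).$$ For $S\subseteq U$, let $G(S,h_1,h_2)$ be the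 bipartite multigraph whose vertex set consists of two disjoint copies of $[m]$ and which has, for every key $x\in S$, one edge joining $h_1(x)$ in the first copy to $h_2(x)$ in the second copy. **Statement.** For every real $\alpha\ge 1$ there are real numbers $\beta\ge 1$, $\delta\in(0,1)$ and $K>0$ and integers $c,s\ge 1$, depending only on $\alpha$, such that the following holds for every finite set $U$, every $S\subseteq U$ with $|S|=n\ge 1$, every integer $m\ge 6n$, $\ell=\lceil n^{\delta}\rceil$, every two-universal hash class $\mathcal F$ with range $[\ell]$ and every two-wise independent hash class $\mathcal H$ with range $[m]$. If $(h_1,h_2)$ is chosen at random from $\mathcal Z^{c,2}_{\ell,m}$ and $G=G(S,h_1,h_2)$, then (a) $\Pr\bigl(G\text{ has a connected component with at least }\beta\log n\text{ vertices}\bigr)\le K\,n^{-\alpha}$; (b) $\Pr\bigl(\text{for some }k,\ G\text{ has a connected component with }k\text{ vertices and at least }k+s-1\text{ edges}\bigr)\le K\,n^{-\alpha}$. -/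

import Mathlib

namespace HashZ

/-- The probability of the event `E` under the uniform distribution on the finite type `Ω`. -/
noncomputable def unifProb (Ω : Type*) (E : Ω → Prop) : ℝ :=
  (Nat.card {ω : Ω // E ω} : ℝ) / (Nat.card Ω : ℝ)

/-- A hash class with functions from `U` to `[m] = {0, …, m - 1}`. -/
abbrev HashClass (U : Type*) (m : ℕ) := Finset (U → Fin m)

/-- `𝓗` is `c`-universal: distinct keys collide with probability at most `c / m`. -/
def IsUniversal {U : Type*} {m : ℕ} (c : ℝ) (𝓗 : HashClass U m) : Prop :=
  ∀ x y : U, x ≠ y → unifProb 𝓗 (fun h => h.1 x = h.1 y) ≤ c / m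

/-- `𝓗` is `κ`-wise independent: the hash values of `κ` distinct keys are uniform and
independent. -/
def IsWiseIndependent {U : Type*} {m : ℕ} (κ : ℕ) (𝓗 : HashClass U m) : Prop :=
  ∀ x : Fin κ → U, Function.Injective x → ∀ j : Fin κ → Fin m,
    unifProb 𝓗 (fun h => ∀ i, h.1 (x i) = j i) = 1 / (m : ℝ) ^ κ

/-- An element of the class `𝓩^{c,d}_{ℓ,m}(𝓕, 𝓗)`, given by its components: functions
`f₁, …, f_d ∈ 𝓗`, functions `g₁, …, g_c ∈ 𝓕`, and tables `z⁽ⁱ⁾[1..c, 0..ℓ-1]`, `1 ≤ i ≤ d`, with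
entries in `[m]`. Uniform distribution on this type means that all the `fᵢ`, all the `gⱼ` and all
the table entries are chosen independently and uniformly. -/
abbrev ClassZ {U : Type*} (c d : ℕ) {ℓ m : ℕ} (𝓕 : HashClass U ℓ) (𝓗 : HashClass U m) :=
  (Fin d → 𝓗) × (Fin c → 𝓕) × (Fin d → Fin c → Fin ℓ → Fin m)

/-- The hash function `hᵢ(x) = (fᵢ(x) + ∑ⱼ z⁽ⁱ⁾[j, gⱼ(x)]) mod m` of an element of the class. -/
def ClassZ.hash {U : Type*} {c d ℓ m : ℕ} {𝓕 : HashClass U ℓ} {𝓗 : HashClass U m}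
    (p : ClassZ c d 𝓕 𝓗) (i : Fin d) (x : U) : Fin m :=
  ⟨(((p.1 i).1 x : ℕ) + ∑ j : Fin c, (p.2.2 i j ((p.2.1 j).1 x) : ℕ)) % m,
    Nat.mod_lt _ (Fin.pos ((p.1 i).1 x))⟩

/-- The bipartite multigraph `G(S, h₁, h₂)`: its vertices are two disjoint copies of `[m]`, and
every key `x ∈ S` is an edge, joining `h₁(x)` in the first copy to `h₂(x)` in the second. -/
def hashGraph {U : Type*} {m : ℕ} (S : Finset U) (h₁ h₂ : U → Fin m) :
    Graph (Fin m ⊕ Fin m) U where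
  vertexSet := Set.univ
  edgeSet := {x | x ∈ S}
  IsLink x v w := x ∈ S ∧ ((v = Sum.inl (h₁ x) ∧ w = Sum.inr (h₂ x)) ∨
    (v = Sum.inr (h₂ x) ∧ w = Sum.inl (h₁ x)))
  isLink_symm := fun _ _ => ⟨fun _ _ h => ⟨h.1, h.2.symm.imp And.symm And.symm⟩⟩
  eq_or_eq_of_isLink_of_isLink := by
    rintro e x y v w ⟨-, ⟨rfl, rfl⟩ | ⟨rfl, rfl⟩⟩ ⟨-, ⟨rfl, rfl⟩ | ⟨rfl, rfl⟩⟩ <;> simp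
  edge_mem_iff_exists_isLink := fun x =>
    ⟨fun hx => ⟨_, _, hx, Or.inl ⟨rfl, rfl⟩⟩, fun ⟨_, _, hx, _⟩ => hx⟩
  left_mem_of_isLink := fun _ _ _ _ => Set.mem_univ _

/-- `C` is (the vertex set of) a connected component of the multigraph `G`: the set of all
vertices that can be reached along edges of `G` from some vertex `v` of `G`. -/
def IsComponent {V E : Type*} (G : Graph V E) (C : Set V) : Prop :=
  ∃ v ∈ G.vertexSet, C = {w | Relation.ReflTransGen G.Adj v w}

/-- The edges of `G` (with multiplicities) that belong to the component with vertex set `C`. -/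
def componentEdges {V E : Type*} (G : Graph V E) (C : Set V) : Set E :=
  {e | ∃ v ∈ C, G.Inc e v}

/-- `G` has a connected component with at least `b` vertices. -/
def HasLargeComponent {V E : Type*} (G : Graph V E) (b : ℝ) : Prop :=
  ∃ C : Set V, IsComponent G C ∧ b ≤ (C.ncard : ℝ)

/-- For some `k`, `G` has a connected component with `k` vertices and at least `k + s - 1`
edges. -/
def HasDenseComponent {V E : Type*} (G : Graph V E) (s : ℕ) : Prop :=
  ∃ (C : Set V) (k : ℕ), IsComponent G C ∧ C.ncard = k ∧
    k + s - 1 ≤ (componentEdges G C).ncard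

end HashZ

/-! The proof is a first-moment bound over search trees. Breadth first search lists edges of a
component so that each joins a listed vertex to a new one; the shape is a monotone sequence `q` with
`q i ≤ i`, so there are at most `4 ^ t` shapes with `t` edges (`card_treeCode_le`). For fully random
hash functions, `n ^ t` key sequences and `m ^ (t + 1)` vertex placements out of `m ^ (2 * t)` bound
the expected number of trees by `6 * n * (2 / 3) ^ t`, which is small once `t` is a large multiple
of `log n`. Each additional edge inside the tree costs a further factor `t ^ 2 / n`, so boundedly
many of them suffice for (b) when `t = O(log n)`.

The hash functions are random enough for this. With the `g`s fixed, the hash values of a key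
sequence behave as if fully random once some `g j` is injective on it up to one key: row `j` of the
table randomises the other keys, and two-wise independence of `𝓗` handles a remaining collision
(`unifProb_preHash_eq_le`). If no `g j` is that good, cut the sequence at a prefix on which some `g
j` is almost injective, but on whose extension by one key none is. The prefix still describes a
connected graph with random hash values, yet no `g j` is injective on it, which has probability at
most `(2 * r ^ 2 / ℓ) ^ c` (`unifProb_not_injective_le`). A large `c` pays for `n`, for `4 ^ t = n ^
O(1)` and for the logarithmic factors.

`unifProb_hasTree_le` is the resulting bound; `hasTree_of_le_ncard` and `hasTree_of_dense` extract
the trees from components. -/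

namespace HashZ

/-! ### Uniform probability: union bound, products, conditioning. -/

section UnifProb

variable {Ω Ω' A B ι : Type*}

theorem unifProb_nonneg (E : Ω → Prop) : 0 ≤ unifProb Ω E := by
  unfold unifProb; positivity

theorem unifProb_mono [Finite Ω] {E E' : Ω → Prop} (h : ∀ ω, E ω → E' ω) :
    unifProb Ω E ≤ unifProb Ω E' := by
  unfold unifProb
  gcongr
  exact Nat.card_le_card_of_injective (Subtype.map id h) (Subtype.map_injective h Function.injective_id)

theorem unifProb_le_one [Finite Ω] (E : Ω → Prop) : unifProb Ω E ≤ 1 := by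
  unfold unifProb
  apply div_le_one_of_le₀ _ (by positivity)
  exact_mod_cast Nat.card_le_card_of_injective (Subtype.val : {ω // E ω} → Ω)
    Subtype.val_injective

theorem unifProb_exists_le [Finite Ω] [Fintype ι] (E : ι → Ω → Prop) :
    unifProb Ω (fun ω => ∃ i, E i ω) ≤ ∑ i, unifProb Ω (E i) := by
  unfold unifProb
  rw [← Finset.sum_div]
  gcongr
  have h := Nat.card_le_card_of_surjective
    (fun p : Σ i, {ω // E i ω} => (⟨p.2.1, p.1, p.2.2⟩ : {ω // ∃ i, E i ω}))
    (fun ⟨ω, i, hi⟩ => ⟨⟨i, ω, hi⟩, rfl⟩)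
  rw [Nat.card_sigma] at h
  exact_mod_cast h

theorem unifProb_or_le [Finite Ω] (E E' : Ω → Prop) :
    unifProb Ω (fun ω => E ω ∨ E' ω) ≤ unifProb Ω E + unifProb Ω E' := by
  have h := unifProb_exists_le (fun b : Bool => if b then E else E')
  simpa [Bool.exists_bool, or_comm] using h

theorem unifProb_comp_equiv (e : Ω ≃ Ω') (E : Ω' → Prop) :
    unifProb Ω (fun ω => E (e ω)) = unifProb Ω' E := by
  unfold unifProb
  rw [Nat.card_congr e, Nat.card_congr (e.subtypeEquiv (p := fun ω => E (e ω)) (q := E)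
    fun _ => Iff.rfl)]

theorem unifProb_pi [Fintype ι] (E : ι → A → Prop) :
    unifProb (ι → A) (fun a => ∀ i, E i (a i)) = ∏ i, unifProb A (E i) := by
  unfold unifProb
  rw [Nat.card_congr (Equiv.subtypePiEquivPi (p := fun i a => E i a)), Nat.card_pi, Nat.card_pi,
    Finset.prod_div_distrib]
  push_cast
  rfl

/-- Conditioning on the second coordinate; used with the `g`s, or the tables, held fixed. -/
theorem unifProb_prod_le [Finite A] [Finite B] {E : A × B → Prop} {Q : B → Prop} {p : ℝ}
    (hEQ : ∀ a b, E (a, b) → Q b)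
    (hp : ∀ b, Q b → unifProb A (fun a => E (a, b)) ≤ p) :
    unifProb (A × B) E ≤ p * unifProb B Q := by
  classical
  have := Fintype.ofFinite A
  have := Fintype.ofFinite B
  rcases isEmpty_or_nonempty A with hA | hA
  · have hz : ∀ F : A → Prop, unifProb A F = 0 := fun F => by simp [unifProb]
    have h0 : unifProb (A × B) E = 0 := by simp [unifProb]
    rw [h0]
    by_cases hQ : ∃ b, Q b
    · obtain ⟨b, hb⟩ := hQ
      have := hp b hb
      rw [hz] at this
      exact mul_nonneg this (unifProb_nonneg _)
    · have : IsEmpty {b // Q b} := ⟨fun b => hQ ⟨b.1, b.2⟩⟩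
      simp [unifProb]
  · let e : {ab : A × B // E ab} ≃ Σ b : {b // Q b}, {a // E (a, b.1)} :=
      { toFun := fun ab => ⟨⟨ab.1.2, hEQ _ _ ab.2⟩, ab.1.1, ab.2⟩
        invFun := fun s => ⟨(s.2.1, s.1.1), s.2.2⟩
        left_inv := fun _ => rfl
        right_inv := fun _ => rfl }
    have hA' : (0 : ℝ) < Nat.card A := by exact_mod_cast Nat.card_pos
    unfold unifProb
    rw [Nat.card_congr e, Nat.card_sigma, Nat.card_prod]
    push_cast
    rw [← div_div, mul_div_assoc']
    gcongr
    rw [Finset.sum_div]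
    calc ∑ b : {b // Q b}, (Nat.card {a // E (a, b.1)} : ℝ) / Nat.card A
        ≤ ∑ _b : {b // Q b}, p := Finset.sum_le_sum fun b _ => hp b.1 b.2
      _ = p * Nat.card {b // Q b} := by
        rw [Finset.sum_const, Finset.card_univ, nsmul_eq_mul, Nat.card_eq_fintype_card, mul_comm]

end UnifProb

/-! ### Randomness of the hash values for fixed `g`s. -/

section Randomness

variable {U A κ : Type*} {c ℓ m : ℕ}

/-- The value `φ a x + ∑ᵢ z[i, gᵢ(x)]` before reduction modulo `m`. -/
def preHash (φ : A → U → Fin m) (g : Fin c → U → Fin ℓ) (p : A × (Fin c → Fin ℓ → Fin m))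
    (x : U) : ℕ :=
  (φ p.1 x : ℕ) + ∑ i, (p.2 i (g i x) : ℕ)

/-- The part of `preHash` that does not depend on row `j` of the table. -/
def partialHash (φ : A → U → Fin m) (g : Fin c → U → Fin ℓ) (j : Fin c)
    (p : A × (Fin c → Fin ℓ → Fin m)) (x : U) : ℕ :=
  (φ p.1 x : ℕ) + ∑ i ∈ Finset.univ.erase j, (p.2 i (g i x) : ℕ)

theorem preHash_eq (φ : A → U → Fin m) (g : Fin c → U → Fin ℓ) (j : Fin c)
    (p : A × (Fin c → Fin ℓ → Fin m)) (x : U) :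
    preHash φ g p x = partialHash φ g j p x + p.2 j (g j x) := by
  unfold preHash partialHash
  rw [← Finset.add_sum_erase _ _ (Finset.mem_univ j)]
  ring

theorem partialHash_congr (φ : A → U → Fin m) (g : Fin c → U → Fin ℓ) (j : Fin c) (a : A)
    {z z' : Fin c → Fin ℓ → Fin m} (h : ∀ i, i ≠ j → z i = z' i) (x : U) :
    partialHash φ g j (a, z) x = partialHash φ g j (a, z') x := by
  unfold partialHash
  congr 1
  exact Finset.sum_congr rfl fun i hi => by
    simp only
    rw [h i (Finset.ne_of_mem_erase hi)]

theorem fin_eq_of_add_modEq {a : ℕ} {u w : Fin m} (h : (a + u) % m = (a + w) % m) : u = w := by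
  have h' : (u : ℕ) ≡ w [MOD m] := Nat.ModEq.add_left_cancel' a h
  exact Fin.ext (Nat.ModEq.eq_of_lt_of_lt h' u.2 w.2)

/-- Prescribing the hash values of keys on which `gⱼ` is injective loses a factor `m` for each
key, independently of all events that do not depend on row `j` of the table. -/
theorem card_preHash_mul_le [Finite A] [Finite κ] (φ : A → U → Fin m) (g : Fin c → U → Fin ℓ)
    (j : Fin c) (x : κ → U) (hinj : Function.Injective fun k => g j (x k)) (v : κ → Fin m)
    (R : A × (Fin c → Fin ℓ → Fin m) → Prop)
    (hR : ∀ a z z', (∀ i, i ≠ j → z i = z' i) → R (a, z) → R (a, z')) :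
    Nat.card {p : A × (Fin c → Fin ℓ → Fin m) // (∀ k, preHash φ g p (x k) % m = v k) ∧ R p} *
      m ^ Nat.card κ ≤ Nat.card {p : A × (Fin c → Fin ℓ → Fin m) // R p} := by
  classical
  have hm : m ^ Nat.card κ = Nat.card (κ → Fin m) := by
    rw [Nat.card_fun]; simp
  rw [hm, ← Nat.card_prod]
  have hne : ∀ (z : Fin c → Fin ℓ → Fin m) (y : Fin ℓ → Fin m) i, i ≠ j →
      z i = Function.update z j y i := fun z y i hi => (Function.update_of_ne hi _ _).symm
  -- The entries of row `j` used by the keys are overwritten with arbitrary `w`. This is injective: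
  -- the old entries can be recovered from the prescribed hash values.
  let F : {p : A × (Fin c → Fin ℓ → Fin m) // (∀ k, preHash φ g p (x k) % m = v k) ∧ R p} ×
      (κ → Fin m) → {p : A × (Fin c → Fin ℓ → Fin m) // R p} := fun q =>
    ⟨(q.1.1.1, Function.update q.1.1.2 j
      (Function.extend (fun k => g j (x k)) q.2 (q.1.1.2 j))),
      hR _ _ _ (hne _ _) q.1.2.2⟩
  apply Nat.card_le_card_of_injective F
  rintro ⟨⟨⟨a, z⟩, hz, hzR⟩, w⟩ ⟨⟨⟨a', z'⟩, hz', hzR'⟩, w'⟩ h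
  simp only [F, Subtype.mk.injEq, Prod.mk.injEq] at h
  obtain ⟨rfl, h⟩ := h
  have hj := congrFun h j
  simp only [Function.update_self] at hj
  have hoff : ∀ i, i ≠ j → z i = z' i := fun i hi => by
    have := congrFun h i
    rwa [Function.update_of_ne hi, Function.update_of_ne hi] at this
  have hw : w = w' := by
    funext k
    have := congrFun hj (g j (x k))
    rwa [hinj.extend_apply, hinj.extend_apply] at this
  have hzz : z = z' := by
    funext i
    by_cases hi : i = j
    · subst hi
      funext y
      by_cases hy : ∃ k, g i (x k) = y
      · obtain ⟨k, rfl⟩ := hy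
        have h1 := (hz k).trans (hz' k).symm
        rw [preHash_eq _ _ i, preHash_eq _ _ i, partialHash_congr φ g i a hoff] at h1
        exact fin_eq_of_add_modEq h1
      · have := congrFun hj y
        rwa [Function.extend_apply' _ _ _ hy, Function.extend_apply' _ _ _ hy] at this
    · exact hoff i hi
  subst hw hzz
  rfl

theorem unifProb_preHash_le [Finite A] [Finite κ] (φ : A → U → Fin m) (g : Fin c → U → Fin ℓ)
    (j : Fin c) (x : κ → U) (hinj : Function.Injective fun k => g j (x k)) (v : κ → Fin m)
    (R : A × (Fin c → Fin ℓ → Fin m) → Prop)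
    (hR : ∀ a z z', (∀ i, i ≠ j → z i = z' i) → R (a, z) → R (a, z')) :
    unifProb (A × (Fin c → Fin ℓ → Fin m))
      (fun p => (∀ k, preHash φ g p (x k) % m = v k) ∧ R p) ≤
      unifProb (A × (Fin c → Fin ℓ → Fin m)) R / (m : ℝ) ^ Nat.card κ := by
  have h := card_preHash_mul_le φ g j x hinj v R hR
  have hpos : (0 : ℝ) < (m : ℝ) ^ Nat.card κ := by
    rcases isEmpty_or_nonempty κ with hκ | ⟨⟨k⟩⟩
    · simp
    · have : 0 < m := Fin.pos (v k)
      positivity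
  unfold unifProb
  rw [le_div_iff₀ hpos, div_mul_eq_mul_div]
  gcongr
  exact_mod_cast h

/-- Given the value of `f y`, at most one value of `f x` satisfies the congruence. -/
theorem unifProb_modEq_le {𝓗 : HashClass U m} (h𝓗 : IsWiseIndependent 2 𝓗) {x y : U}
    (hxy : x ≠ y) (a b : ℕ) :
    unifProb 𝓗 (fun f => (f.1 x : ℕ) + a ≡ (f.1 y : ℕ) + b [MOD m]) ≤ 1 / m := by
  have key : ∀ i : Fin m, unifProb 𝓗 (fun f => f.1 y = i ∧
      (f.1 x : ℕ) + a ≡ (f.1 y : ℕ) + b [MOD m]) ≤ 1 / (m : ℝ) ^ 2 := by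
    intro i
    by_cases hk : ∃ k : Fin m, (k : ℕ) + a ≡ (i : ℕ) + b [MOD m]
    · obtain ⟨k, hk⟩ := hk
      rw [← h𝓗 ![x, y] (by
        intro s t; fin_cases s <;> fin_cases t <;> simp [hxy, hxy.symm]) ![k, i]]
      apply unifProb_mono
      rintro f ⟨h1, h2⟩
      rw [h1] at h2
      have h3 : ((f.1 x : Fin m) : ℕ) ≡ k [MOD m] :=
        Nat.ModEq.add_right_cancel' a (h2.trans hk.symm)
      have h4 : f.1 x = k := Fin.ext (Nat.ModEq.eq_of_lt_of_lt h3 (Fin.is_lt _) k.2)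
      simp [Fin.forall_fin_two, h1, h4]
    · have : IsEmpty {f : 𝓗 // f.1 y = i ∧ (f.1 x : ℕ) + a ≡ (f.1 y : ℕ) + b [MOD m]} := by
        refine ⟨fun f => hk ⟨f.1.1 x, ?_⟩⟩
        have := f.2.2
        rwa [f.2.1] at this
      simp only [unifProb, Nat.card_of_isEmpty]
      simp
  calc unifProb 𝓗 (fun f => (f.1 x : ℕ) + a ≡ (f.1 y : ℕ) + b [MOD m])
      ≤ unifProb 𝓗 (fun f => ∃ i : Fin m, f.1 y = i ∧
        (f.1 x : ℕ) + a ≡ (f.1 y : ℕ) + b [MOD m]) := unifProb_mono fun f hf => ⟨_, rfl, hf⟩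
    _ ≤ ∑ _i : Fin m, 1 / (m : ℝ) ^ 2 :=
      (unifProb_exists_le _).trans (Finset.sum_le_sum fun i _ => key i)
    _ ≤ 1 / m := by
      rcases Nat.eq_zero_or_pos m with rfl | hm
      · simp
      · simp only [Finset.sum_const, Finset.card_univ, Fintype.card_fin, nsmul_eq_mul]
        apply le_of_eq
        field_simp

/-- If `gⱼ` is injective on the given keys up to leaving out one of them, then the hash values
of the keys are uniform and independent. -/
theorem unifProb_preHash_eq_le {𝓗 : HashClass U m} (h𝓗 : IsWiseIndependent 2 𝓗)
    (g : Fin c → U → Fin ℓ) (j : Fin c) {r : ℕ} (x : Fin r → U) (hx : Function.Injective x)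
    (b : ℕ) (hb : ∀ k k' : Fin r, k.1 ≠ b → k'.1 ≠ b → g j (x k) = g j (x k') → k = k')
    (v : Fin r → Fin m) :
    unifProb (𝓗 × (Fin c → Fin ℓ → Fin m))
      (fun p => ∀ k, preHash (fun f : 𝓗 => f.1) g p (x k) % m = v k) ≤ 1 / (m : ℝ) ^ r := by
  classical
  by_cases hinj : Function.Injective fun k => g j (x k)
  · have h := unifProb_preHash_le (fun f : 𝓗 => f.1) g j x hinj v (fun _ => True)
      (fun _ _ _ _ h => h)
    simp only [and_true, Nat.card_eq_fintype_card, Fintype.card_fin] at h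
    refine h.trans ?_
    gcongr
    exact unifProb_le_one _
  · obtain ⟨i, k, hik, hne⟩ := Function.not_injective_iff.mp hinj
    -- Any collision under `g j` must involve the left-out key.
    obtain ⟨a, b', hab, hab', hbb⟩ : ∃ a b' : Fin r, g j (x a) = g j (x b') ∧ a ≠ b' ∧
        b'.1 = b := by
      by_cases h1 : i.1 = b
      · exact ⟨k, i, hik.symm, hne.symm, h1⟩
      · by_cases h2 : k.1 = b
        · exact ⟨i, k, hik, hne, h2⟩
        · exact absurd (hb i k h1 h2 hik) hne
    have hm : 0 < m := Fin.pos (v a)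
    -- The keys `x a` and `x b'` use the same entry of row `j`, which cancels: comparing their hash
    -- values gives an event independent of that row. It costs one factor `1 / m`, and the keys
    -- other than `x b'` cost one each through row `j`.
    let R : 𝓗 × (Fin c → Fin ℓ → Fin m) → Prop := fun p =>
      partialHash (fun f : 𝓗 => f.1) g j p (x a) + v b' ≡
        partialHash (fun f : 𝓗 => f.1) g j p (x b') + v a [MOD m]
    have hR : ∀ f z z', (∀ i, i ≠ j → z i = z' i) → R (f, z) → R (f, z') := by
      intro f z z' hz h
      simp only [R] at h ⊢
      rwa [← partialHash_congr _ g j f hz, ← partialHash_congr _ g j f hz]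
    have hRp : unifProb (𝓗 × (Fin c → Fin ℓ → Fin m)) R ≤ 1 / m := by
      refine (unifProb_prod_le (Q := fun _ => True) (p := 1 / (m : ℝ)) (fun _ _ _ => trivial)
        fun z _ => ?_).trans ?_
      · refine le_trans (le_of_eq ?_) (unifProb_modEq_le h𝓗 (hx.ne hab')
          (∑ i ∈ Finset.univ.erase j, (z i (g i (x a)) : ℕ) + v b')
          (∑ i ∈ Finset.univ.erase j, (z i (g i (x b')) : ℕ) + v a))
        simp only [R, partialHash, add_assoc]
      · exact mul_le_of_le_one_right (by positivity) (unifProb_le_one _)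
    have hcard : Nat.card {k : Fin r // k ≠ b'} = r - 1 := by
      simp [Nat.card_eq_fintype_card]
    have hr : r = (r - 1) + 1 := by have := a.2; omega
    have h := unifProb_preHash_le (fun f : 𝓗 => f.1) g j (fun k : {k : Fin r // k ≠ b'} => x k)
      (fun k k' hk => Subtype.ext (hb _ _
        (fun h => k.2 (Fin.ext (h.trans hbb.symm))) (fun h => k'.2 (Fin.ext (h.trans hbb.symm)))
        hk)) (fun k => v k) R hR
    calc _ ≤ _ := unifProb_mono fun p hp => ⟨fun k : {k : Fin r // k ≠ b'} => hp k, ?_⟩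
      _ ≤ _ := h
      _ ≤ 1 / m / (m : ℝ) ^ (r - 1) := by rw [hcard]; gcongr
      _ = 1 / (m : ℝ) ^ r := by
        conv_rhs => rw [hr, pow_succ']
        rw [div_div]
    have ha := hp a
    have hb' := hp b'
    rw [preHash_eq _ _ j] at ha hb'
    rw [hab] at ha
    have ha' : partialHash (fun f : 𝓗 => f.1) g j p (x a) + (p.2 j (g j (x b')) : ℕ) ≡ v a
        [MOD m] := by rw [Nat.ModEq, ha, Nat.mod_eq_of_lt (v a).2]
    have hb'' : partialHash (fun f : 𝓗 => f.1) g j p (x b') + (p.2 j (g j (x b')) : ℕ) ≡ v b'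
        [MOD m] := by rw [Nat.ModEq, hb', Nat.mod_eq_of_lt (v b').2]
    refine Nat.ModEq.add_right_cancel' (p.2 j (g j (x b')) : ℕ) ?_
    calc _ = (partialHash (fun f : 𝓗 => f.1) g j p (x a) + (p.2 j (g j (x b')) : ℕ)) + v b' := by
          ring
      _ ≡ v a + (partialHash (fun f : 𝓗 => f.1) g j p (x b') + (p.2 j (g j (x b')) : ℕ)) [MOD m] :=
        Nat.ModEq.add ha' hb''.symm
      _ = _ := by ring

end Randomness

/-! ### Union bound over key sequences and incidence patterns. -/

section Patterns

variable {U : Type*} {c ℓ m : ℕ}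

/-- `g` is injective on the sequence `x` up to leaving out one entry. -/
def AlmostInjective {r : ℕ} (g : U → Fin ℓ) (x : Fin r → U) : Prop :=
  ∃ b : ℕ, ∀ k k' : Fin r, k.1 ≠ b → k'.1 ≠ b → g (x k) = g (x k') → k = k'

/-- For fixed `g`s the two hash functions are independent, so each admissible table of values costs
`1 / m ^ (2 * r)`. The event `Q` on the `g`s factors out. -/
theorem unifProb_hash_mem_le {𝓕 : HashClass U ℓ} {𝓗 : HashClass U m}
    (h𝓗 : IsWiseIndependent 2 𝓗) {r : ℕ} (x : Fin r → U) (hx : Function.Injective x)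
    (Q : (Fin c → 𝓕) → Prop) (M : (Fin 2 → Fin r → Fin m) → Prop) :
    unifProb (ClassZ c 2 𝓕 𝓗) (fun p => (∃ j, AlmostInjective (p.2.1 j).1 x) ∧ Q p.2.1 ∧
      M (fun i k => ClassZ.hash p i (x k))) ≤
      Nat.card {v // M v} / (m : ℝ) ^ (2 * r) * unifProb (Fin c → 𝓕) Q := by
  classical
  let e : ClassZ c 2 𝓕 𝓗 ≃ (Fin 2 → 𝓗 × (Fin c → Fin ℓ → Fin m)) × (Fin c → 𝓕) :=
    { toFun := fun p => (fun i => (p.1 i, p.2.2 i), p.2.1)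
      invFun := fun p => (fun i => (p.1 i).1, p.2, fun i => (p.1 i).2)
      left_inv := fun _ => rfl
      right_inv := fun _ => rfl }
  let E : (Fin 2 → 𝓗 × (Fin c → Fin ℓ → Fin m)) × (Fin c → 𝓕) → Prop := fun p =>
    (∃ j, AlmostInjective (p.2 j).1 x) ∧ Q p.2 ∧
      M (fun i k => ClassZ.hash (e.symm p) i (x k))
  have h1 := unifProb_comp_equiv e E
  refine (le_of_eq h1).trans (unifProb_prod_le (fun a g h => h.2.1) fun g _ => ?_)
  by_cases hg : ∃ j, AlmostInjective (g j).1 x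
  · obtain ⟨j, b, hb⟩ := hg
    calc _ ≤ unifProb (Fin 2 → 𝓗 × (Fin c → Fin ℓ → Fin m)) (fun a => ∃ v : {v // M v},
          ∀ i k, preHash (fun f : 𝓗 => f.1) (fun j => (g j).1) (a i) (x k) % m = v.1 i k) :=
        unifProb_mono fun a ha => ⟨⟨_, ha.2.2⟩, fun i k => rfl⟩
      _ ≤ ∑ v : {v // M v}, (1 / (m : ℝ) ^ (2 * r)) := by
        refine (unifProb_exists_le _).trans (Finset.sum_le_sum fun v _ => ?_)
        refine (le_of_eq (unifProb_pi (fun i (p : 𝓗 × (Fin c → Fin ℓ → Fin m)) => ∀ k,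
          preHash (fun f : 𝓗 => f.1) (fun j => (g j).1) p (x k) % m = v.1 i k))).trans ?_
        calc _ ≤ ∏ _i : Fin 2, 1 / (m : ℝ) ^ r :=
              Finset.prod_le_prod (fun _ _ => unifProb_nonneg _) fun i _ =>
                unifProb_preHash_eq_le h𝓗 (fun j => (g j).1) j x hx b hb (v.1 i)
          _ = _ := by
            simp only [Finset.prod_const, Finset.card_univ, Fintype.card_fin]
            rw [div_pow, one_pow, ← pow_mul, mul_comm]
      _ = _ := by
        rw [Finset.sum_const, Finset.card_univ, nsmul_eq_mul, Nat.card_eq_fintype_card,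
          mul_one_div]
  · have : IsEmpty {a // E (a, g)} := ⟨fun a => hg a.2.1⟩
    simp only [unifProb, Nat.card_of_isEmpty, Nat.cast_zero, zero_div]
    positivity

theorem unifProb_not_injective_le {𝓕 : HashClass U ℓ} (h𝓕 : IsUniversal 2 𝓕) {r : ℕ}
    (x : Fin r → U) (hx : Function.Injective x) :
    unifProb (Fin c → 𝓕) (fun g => ∀ j, ¬ Function.Injective fun k => (g j).1 (x k)) ≤
      (2 * (r : ℝ) ^ 2 / ℓ) ^ c := by
  have h1 : unifProb 𝓕 (fun g => ¬ Function.Injective fun k => g.1 (x k)) ≤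
      2 * (r : ℝ) ^ 2 / ℓ := by
    calc _ ≤ unifProb 𝓕 (fun g => ∃ k : Fin r × Fin r,
          k.1 ≠ k.2 ∧ g.1 (x k.1) = g.1 (x k.2)) := unifProb_mono fun g hg => by
            obtain ⟨i, k, hik, hne⟩ := Function.not_injective_iff.mp hg
            exact ⟨(i, k), hne, hik⟩
      _ ≤ ∑ k : Fin r × Fin r, (2 / (ℓ : ℝ)) := by
        refine (unifProb_exists_le _).trans (Finset.sum_le_sum fun k _ => ?_)
        by_cases hk : k.1 = k.2
        · have : IsEmpty {g : 𝓕 // k.1 ≠ k.2 ∧ g.1 (x k.1) = g.1 (x k.2)} :=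
            ⟨fun g => g.2.1 hk⟩
          simp only [unifProb, Nat.card_of_isEmpty, Nat.cast_zero, zero_div]
          positivity
        · exact (unifProb_mono fun g hg => hg.2).trans (h𝓕 _ _ (hx.ne hk))
      _ = _ := by simp; ring
  refine (le_of_eq (unifProb_pi (fun _ (g : 𝓕) =>
    ¬ Function.Injective fun k => g.1 (x k)))).trans ?_
  calc _ ≤ ∏ _i : Fin c, (2 * (r : ℝ) ^ 2 / ℓ) :=
        Finset.prod_le_prod (fun _ _ => unifProb_nonneg _) fun i _ => h1
    _ = _ := by rw [Finset.prod_const, Finset.card_univ, Fintype.card_fin]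

/-- The entries of `v` satisfy the equations `v σ i = v σ (P σ i)`. -/
def Matches (P : Fin 2 → ℕ → ℕ) {r : ℕ} (v : Fin 2 → Fin r → Fin m) : Prop :=
  ∀ σ (i a : Fin r), P σ i = a → v σ i = v σ a

/-- All equations point backwards, so the values at the fixed points of `P` determine `v`. -/
theorem card_matches_le (P : Fin 2 → ℕ → ℕ) (hP : ∀ σ i, P σ i ≤ i) (r m : ℕ) :
    Nat.card {v : Fin 2 → Fin r → Fin m // Matches P v} ≤
      m ^ Nat.card {p : Fin 2 × Fin r // P p.1 p.2 = p.2} := by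
  classical
  have hm : m ^ Nat.card {p : Fin 2 × Fin r // P p.1 p.2 = p.2} =
      Nat.card ({p : Fin 2 × Fin r // P p.1 p.2 = p.2} → Fin m) := by
    rw [Nat.card_fun]; simp
  rw [hm]
  apply Nat.card_le_card_of_injective (fun v p => v.1 p.1.1 p.1.2)
  rintro ⟨v, hv⟩ ⟨w, hw⟩ h
  apply Subtype.ext
  funext σ i
  obtain ⟨i, hi⟩ := i
  induction i using Nat.strong_induction_on with
  | _ i ih =>
    rcases (hP σ i).eq_or_lt with h' | h'
    · exact congrFun h ⟨(σ, ⟨i, hi⟩), h'⟩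
    · have := ih _ h' (h'.trans hi)
      exact (hv σ ⟨i, hi⟩ ⟨_, h'.trans hi⟩ rfl).trans
        (this.trans (hw σ ⟨i, hi⟩ ⟨_, h'.trans hi⟩ rfl).symm)

/-- The equations of `P` attach every edge to earlier edges: at one end at least, and from the
`t`-th edge on at both ends. -/
structure IsAttaching (t : ℕ) (P : Fin 2 → ℕ → ℕ) : Prop where
  le : ∀ σ i, P σ i ≤ i
  exists_ne : ∀ i, i ≠ 0 → ∃ σ, P σ i ≠ i
  ne : ∀ σ i, t ≤ i → P σ i ≠ i

/-- The first edge has at most two free ends, the later tree edges at most one each, the additional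
edges none. -/
theorem IsAttaching.card_free_le {t : ℕ} {P : Fin 2 → ℕ → ℕ} (hP : IsAttaching t P) (r : ℕ) :
    Nat.card {p : Fin 2 × Fin r // P p.1 p.2 = p.2} ≤ min r t + 1 := by
  classical
  have hle : ∀ i : ℕ, (∑ σ, if P σ i = i then 1 else 0) ≤
      (if i = 0 then 1 else 0) + if i < t then 1 else 0 := by
    intro i
    rw [Fin.sum_univ_two]
    by_cases hi : t ≤ i
    · simp [hP.ne _ i hi]
    · rw [if_pos (not_le.mp hi)]
      by_cases h0 : i = 0
      · rw [if_pos h0]; split_ifs <;> simp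
      · obtain ⟨σ, hσ⟩ := hP.exists_ne i h0
        rw [if_neg h0]
        match σ, hσ with
        | 0, hσ => rw [if_neg hσ]; split_ifs <;> simp
        | 1, hσ => rw [if_neg hσ]; split_ifs <;> simp
  rw [Nat.card_eq_fintype_card, Fintype.card_subtype, Finset.card_filter,
    Fintype.sum_prod_type_right]
  calc _ ≤ ∑ i : Fin r, ((if (i : ℕ) = 0 then 1 else 0) + if (i : ℕ) < t then 1 else 0) :=
        Finset.sum_le_sum fun i _ => hle i
    _ = ∑ i ∈ Finset.range r, ((if i = 0 then 1 else 0) + if i < t then 1 else 0) :=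
        Fin.sum_univ_eq_sum_range (fun i => (if i = 0 then 1 else 0) + if i < t then 1 else 0) r
    _ ≤ 1 + min r t := by
      rw [Finset.sum_add_distrib]
      gcongr
      · rw [Finset.sum_ite_eq' (Finset.range r) 0 fun _ => 1]
        split_ifs <;> simp
      · rw [← Finset.card_filter]
        calc _ ≤ (Finset.range (min r t)).card := Finset.card_le_card fun i => by simp
          _ = _ := Finset.card_range _
    _ = _ := add_comm _ _

/-- The first summand covers full sequences on which some `g j` is almost injective. The `r`-th term
of the sum covers the failures cut off at a prefix of `r` keys. -/
theorem unifProb_exists_matches_le_sum {𝓕 : HashClass U ℓ} {𝓗 : HashClass U m}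
    (h𝓕 : IsUniversal 2 𝓕) (h𝓗 : IsWiseIndependent 2 𝓗) (hc : 1 ≤ c) (hm : 1 ≤ m)
    (S : Finset U) {t R : ℕ} (P : Fin 2 → ℕ → ℕ) (hP : IsAttaching t P) :
    unifProb (ClassZ c 2 𝓕 𝓗) (fun p => ∃ x : Fin R → S, Function.Injective x ∧
      Matches P (fun σ k => ClassZ.hash p σ (x k).1)) ≤
      (S.card : ℝ) ^ R * ((m : ℝ) ^ (t + 1) / (m : ℝ) ^ (2 * R)) +
      ∑ r : Fin R, (S.card : ℝ) ^ (r : ℕ) *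
        ((m : ℝ) ^ ((r : ℕ) + 1) / (m : ℝ) ^ (2 * (r : ℕ)) * (2 * ((r : ℕ) : ℝ) ^ 2 / ℓ) ^ c) := by
  classical
  have hm' : (1 : ℝ) ≤ m := by exact_mod_cast hm
  let E₁ : (Fin R → S) → ClassZ c 2 𝓕 𝓗 → Prop := fun x p => Function.Injective x ∧
    (∃ j, AlmostInjective (p.2.1 j).1 (fun k => (x k).1)) ∧ True ∧
      Matches P (fun σ k => ClassZ.hash p σ (x k).1)
  let E₂ : (r : Fin R) → (Fin r → S) → ClassZ c 2 𝓕 𝓗 → Prop := fun r x p =>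
    Function.Injective x ∧ (∃ j, AlmostInjective (p.2.1 j).1 (fun k => (x k).1)) ∧
      (∀ j, ¬ Function.Injective fun k => (p.2.1 j).1 (x k).1) ∧
      Matches P (fun σ k => ClassZ.hash p σ (x k).1)
  have hpow : ∀ r : ℕ, (Fintype.card (Fin r → S) : ℝ) = (S.card : ℝ) ^ r := fun r => by
    simp
  have h₁ : unifProb (ClassZ c 2 𝓕 𝓗) (fun p => ∃ x, E₁ x p) ≤
      (S.card : ℝ) ^ R * ((m : ℝ) ^ (t + 1) / (m : ℝ) ^ (2 * R)) := by
    refine (unifProb_exists_le _).trans ?_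
    rw [← hpow R, ← nsmul_eq_mul, ← Finset.card_univ]
    refine Finset.sum_le_card_nsmul _ _ _ fun x _ => ?_
    by_cases hx : Function.Injective x
    · calc _ ≤ _ := unifProb_mono fun p hp => hp.2
        _ ≤ _ := unifProb_hash_mem_le h𝓗 (fun k => (x k).1)
          (Subtype.val_injective.comp hx) (fun _ => True) (Matches P)
        _ ≤ (m : ℝ) ^ (t + 1) / (m : ℝ) ^ (2 * R) * 1 := by
          have h0 := unifProb_nonneg (Ω := Fin c → 𝓕) (fun _ => True)
          have h1 := unifProb_le_one (Ω := Fin c → 𝓕) (fun _ => True)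
          have hcard : (Nat.card {v : Fin 2 → Fin R → Fin m // Matches P v} : ℝ) ≤
              (m : ℝ) ^ (t + 1) := by
            have := (card_matches_le P hP.le R m).trans (Nat.pow_le_pow_right hm
              ((hP.card_free_le R).trans (Nat.add_le_add_right (min_le_right R t) 1)))
            exact_mod_cast this
          gcongr
        _ = _ := mul_one _
    · have : IsEmpty {p // E₁ x p} := ⟨fun p => hx p.2.1⟩
      simp only [unifProb, Nat.card_of_isEmpty, Nat.cast_zero, zero_div]
      positivity
  have h₂ : ∀ r : Fin R, unifProb (ClassZ c 2 𝓕 𝓗) (fun p => ∃ x, E₂ r x p) ≤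
      (S.card : ℝ) ^ (r : ℕ) *
        ((m : ℝ) ^ ((r : ℕ) + 1) / (m : ℝ) ^ (2 * (r : ℕ)) *
          (2 * ((r : ℕ) : ℝ) ^ 2 / ℓ) ^ c) := by
    intro r
    refine (unifProb_exists_le _).trans ?_
    rw [← hpow r, ← nsmul_eq_mul, ← Finset.card_univ]
    refine Finset.sum_le_card_nsmul _ _ _ fun x _ => ?_
    by_cases hx : Function.Injective x
    · have hx' : Function.Injective fun k => (x k).1 := Subtype.val_injective.comp hx
      calc _ ≤ _ := unifProb_mono fun p hp => hp.2
        _ ≤ _ := unifProb_hash_mem_le h𝓗 (fun k => (x k).1) hx'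
          (fun g => ∀ j, ¬ Function.Injective fun k => (g j).1 (x k).1) (Matches P)
        _ ≤ _ := by
          have hcard : (Nat.card {v : Fin 2 → Fin r → Fin m // Matches P v} : ℝ) ≤
              (m : ℝ) ^ ((r : ℕ) + 1) := by
            have := (card_matches_le P hP.le r m).trans (Nat.pow_le_pow_right hm
              ((hP.card_free_le r).trans (Nat.add_le_add_right (min_le_left (r : ℕ) t) 1)))
            exact_mod_cast this
          have := unifProb_not_injective_le (c := c) h𝓕 _ hx'
          have := unifProb_nonneg (Ω := Fin c → 𝓕)
            (fun g => ∀ j, ¬ Function.Injective fun k => (g j).1 (x k).1)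
          gcongr
    · have : IsEmpty {p // E₂ r x p} := ⟨fun p => hx p.2.1⟩
      simp only [unifProb, Nat.card_of_isEmpty, Nat.cast_zero, zero_div]
      positivity
  calc _ ≤ unifProb (ClassZ c 2 𝓕 𝓗) (fun p => (∃ x, E₁ x p) ∨ ∃ r x, E₂ r x p) := ?_
    _ ≤ _ := (unifProb_or_le _ _).trans (add_le_add h₁
      ((unifProb_exists_le _).trans (Finset.sum_le_sum fun r _ => h₂ r)))
  apply unifProb_mono
  rintro p ⟨x, hx, hM⟩
  let A : ℕ → Prop := fun r => ∃ hr : r ≤ R, ∃ j,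
    AlmostInjective (p.2.1 j).1 (fun k : Fin r => (x (Fin.castLE hr k)).1)
  by_cases hR : A R
  · obtain ⟨_, hj⟩ := hR
    exact Or.inl ⟨x, hx, hj, trivial, hM⟩
  · right
    -- The left-out index is a natural number rather than an element of `Fin r`, so the empty prefix
    -- qualifies.
    have hA0 : A 0 := ⟨Nat.zero_le _, ⟨0, hc⟩, 0, fun k => k.elim0⟩
    have hex : ∃ r, r < R ∧ A r ∧ ¬ A (r + 1) := by
      by_contra hcon
      push Not at hcon
      have : ∀ r, r ≤ R → A r := by
        intro r
        induction r with
        | zero => exact fun _ => hA0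
        | succ r ih => exact fun hr => hcon r hr (ih (by omega))
      exact hR (this R le_rfl)
    obtain ⟨r, hr, ⟨hr', hj⟩, hn⟩ := hex
    -- Were `g j` injective on the first `r` keys, omitting the entry with index `r` would make it
    -- almost injective on `r + 1` keys.
    refine ⟨⟨r, hr⟩, fun k => x (Fin.castLE hr' k),
      fun k k' h => Fin.castLE_injective _ (hx h), hj, fun j hinj => hn ⟨hr, j, r, ?_⟩, ?_⟩
    · intro k k' hk hk' h
      have := @hinj ⟨k, by have := k.2; change (k : ℕ) < r; omega⟩
        ⟨k', by have := k'.2; change (k' : ℕ) < r; omega⟩ h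
      simpa [Fin.ext_iff] using this
    · intro σ i a h
      exact hM σ (Fin.castLE hr' i) (Fin.castLE hr' a) h

theorem unifProb_exists_matches_le {𝓕 : HashClass U ℓ} {𝓗 : HashClass U m}
    (h𝓕 : IsUniversal 2 𝓕) (h𝓗 : IsWiseIndependent 2 𝓗) (hc : 1 ≤ c)
    (S : Finset U) (hS : 1 ≤ S.card) (hm : 6 * S.card ≤ m) {t e : ℕ} (ht : 1 ≤ t)
    (P : Fin 2 → ℕ → ℕ) (hP : IsAttaching t P) :
    unifProb (ClassZ c 2 𝓕 𝓗) (fun p => ∃ x : Fin (t + e) → S, Function.Injective x ∧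
      Matches P (fun σ k => ClassZ.hash p σ (x k).1)) ≤
      6 * S.card * (1 / 6 : ℝ) ^ t * (1 / (S.card : ℝ)) ^ e +
      ((t + e : ℕ) : ℝ) * (S.card * (2 * ((t + e : ℕ) : ℝ) ^ 2 / ℓ) ^ c) := by
  have hm1 : 1 ≤ m := by omega
  refine (unifProb_exists_matches_le_sum h𝓕 h𝓗 hc hm1 S P hP).trans ?_
  generalize S.card = n at *
  have hn : (1 : ℝ) ≤ n := by exact_mod_cast hS
  have hm' : (6 : ℝ) * n ≤ m := by exact_mod_cast hm
  have hm0 : (0 : ℝ) < m := by linarith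
  have hq : (n : ℝ) / m ≤ 1 / 6 := by
    rw [div_le_div_iff₀ hm0 (by norm_num)]; linarith
  have hq1 : (n : ℝ) / m ≤ 1 := by linarith
  have hinv : 1 / (m : ℝ) ≤ 1 / n := one_div_le_one_div_of_le (by linarith) (by linarith)
  refine add_le_add ?_ ?_
  -- There is one vertex more than tree edges, so only `t - 1` factors `n / m` remain; this is the
  -- origin of the 6 in the bound.
  · obtain ⟨t, rfl⟩ : ∃ t', t = t' + 1 := ⟨t - 1, by omega⟩
    have heq : (n : ℝ) ^ (t + 1 + e) * ((m : ℝ) ^ (t + 1 + 1) / (m : ℝ) ^ (2 * (t + 1 + e))) =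
        n * ((n : ℝ) / m) ^ t * ((n / m) * (1 / (m : ℝ))) ^ e := by
      simp only [div_pow, mul_pow, one_pow]
      field_simp
      ring
    rw [heq]
    calc _ ≤ (n : ℝ) * (1 / 6) ^ t * (1 * (1 / n)) ^ e := by gcongr
      _ = _ := by ring
  · have : ∀ r : Fin (t + e), (n : ℝ) ^ (r : ℕ) *
        ((m : ℝ) ^ ((r : ℕ) + 1) / (m : ℝ) ^ (2 * (r : ℕ)) * (2 * ((r : ℕ) : ℝ) ^ 2 / ℓ) ^ c) ≤
        n * (2 * ((t + e : ℕ) : ℝ) ^ 2 / ℓ) ^ c := by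
      rintro ⟨r, hr⟩
      rcases r with _ | r
      · simp only [CharP.cast_eq_zero]
        rw [zero_pow two_ne_zero, mul_zero (2 : ℝ), zero_div, zero_pow (by omega), mul_zero, mul_zero]
        positivity
      · simp only
        rw [← mul_assoc]
        have heq : (n : ℝ) ^ (r + 1) * ((m : ℝ) ^ (r + 1 + 1) / (m : ℝ) ^ (2 * (r + 1))) =
            n * ((n : ℝ) / m) ^ r := by
          simp only [div_pow]
          field_simp
          ring
        rw [heq]
        have hr' : ((r + 1 : ℕ) : ℝ) ≤ ((t + e : ℕ) : ℝ) := by exact_mod_cast hr.le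
        gcongr
        exact mul_le_of_le_one_right (by positivity) (pow_le_one₀ (by positivity) hq1)
    calc _ ≤ _ := Finset.sum_le_card_nsmul _ _ _ fun r _ => this r
      _ = _ := by simp

/-! ### Codes of search trees with additional edges. -/

/-- Breadth first search codes: the `i`-th edge is attached to the `q i`-th vertex. -/
abbrev TreeCode (t : ℕ) := {q : Fin t → Fin t // Monotone q ∧ ∀ i, q i ≤ i}

theorem card_treeCode_le (t : ℕ) : Nat.card (TreeCode t) ≤ 4 ^ t := by
  have hcard : Nat.card (Finset (Fin (2 * t))) = 4 ^ t := by
    rw [Nat.card_eq_fintype_card, Fintype.card_finset, Fintype.card_fin, pow_mul]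
    norm_num
  rw [← hcard]
  -- Adding `i` makes a monotone code strictly increasing, hence determined by its range, a subset
  -- of a set with `2 * t` elements.
  let f : TreeCode t → Fin t → Fin (2 * t) := fun q i => ⟨q.1 i + i, by omega⟩
  have hf : ∀ q, StrictMono (f q) := fun q i j hij => by
    have h1 : q.1 i ≤ q.1 j := q.2.1 hij.le
    simp only [f, Fin.lt_def, Fin.le_def] at *
    omega
  apply Nat.card_le_card_of_injective (fun q => Finset.univ.image (f q))
  intro q q' h
  have h' : Set.range (f q) = Set.range (f q') := by
    have := congrArg (fun s : Finset (Fin (2 * t)) => (s : Set (Fin (2 * t)))) h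
    simpa using this
  have h2 := ((hf q).range_inj (hf q')).mp h'
  apply Subtype.ext
  funext i
  have := congrFun h2 i
  simp only [f, Fin.mk.injEq] at this
  exact Fin.ext (by omega)

/-- The side of the bipartite graph on which the `j`-th vertex of the search lies. -/
def side (q : ℕ → ℕ) : ℕ → Fin 2
  | 0 => 0
  | i + 1 => (side q (min (q i) i)).rev

/-- The equations that describe a tree with code `q` and `e` additional edges, whose end points
are the end points of the edges of the tree given by `a`. -/
def codePattern {t e : ℕ} (q : Fin t → Fin t) (a : Fin 2 → Fin e → Fin t) (σ : Fin 2) (i : ℕ) :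
    ℕ :=
  if h : i < t then
    if σ = side (fun k => if hk : k < t then q ⟨k, hk⟩ else 0) (q ⟨i, h⟩) then q ⟨i, h⟩ - 1 else i
  else if h' : i - t < e then a σ ⟨i - t, h'⟩ else 0

theorem isAttaching_codePattern {t e : ℕ} (ht : 1 ≤ t) (q : TreeCode t)
    (a : Fin 2 → Fin e → Fin t) : IsAttaching t (codePattern q.1 a) where
  le σ i := by
    unfold codePattern
    split_ifs with h h1 h2
    · have := q.2.2 ⟨i, h⟩
      rw [Fin.le_def] at this
      simp only at this
      omega
    · exact le_rfl
    · have := (a σ ⟨i - t, h2⟩).2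
      omega
    · omega
  exists_ne i hi := by
    by_cases h : i < t
    · refine ⟨side (fun k => if hk : k < t then q.1 ⟨k, hk⟩ else 0) (q.1 ⟨i, h⟩), ?_⟩
      unfold codePattern
      rw [dif_pos h, if_pos rfl]
      have := q.2.2 ⟨i, h⟩
      rw [Fin.le_def] at this
      simp only at this
      omega
    · refine ⟨0, ?_⟩
      unfold codePattern
      rw [dif_neg h]
      split_ifs with h2
      · have := (a 0 ⟨i - t, h2⟩).2
        omega
      -- Past the last edge the pattern has the default value 0, which is smaller than `i` because
      -- `1 ≤ t ≤ i`.
      · omega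
  ne σ i h := by
    unfold codePattern
    rw [dif_neg (not_lt.mpr h)]
    split_ifs with h2
    · have := (a σ ⟨i - t, h2⟩).2
      omega
    · omega

/-- The keys in `S` contain a tree with `t` edges and `e` additional edges between vertices of the
tree. -/
def HasTree (S : Finset U) (h : Fin 2 → U → Fin m) (t e : ℕ) : Prop :=
  ∃ (q : TreeCode t) (a : Fin 2 → Fin e → Fin t) (x : Fin (t + e) → S), Function.Injective x ∧
    Matches (codePattern q.1 a) (fun σ k => h σ (x k).1)

theorem unifProb_hasTree_le {𝓕 : HashClass U ℓ} {𝓗 : HashClass U m}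
    (h𝓕 : IsUniversal 2 𝓕) (h𝓗 : IsWiseIndependent 2 𝓗) (hc : 1 ≤ c)
    (S : Finset U) (hS : 1 ≤ S.card) (hm : 6 * S.card ≤ m) {t : ℕ} (ht : 1 ≤ t) (e : ℕ) :
    unifProb (ClassZ c 2 𝓕 𝓗) (fun p => HasTree S (ClassZ.hash p) t e) ≤
      4 ^ t * (t : ℝ) ^ (2 * e) * (6 * S.card * (1 / 6 : ℝ) ^ t * (1 / (S.card : ℝ)) ^ e +
      ((t + e : ℕ) : ℝ) * (S.card * (2 * ((t + e : ℕ) : ℝ) ^ 2 / ℓ) ^ c)) := by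
  classical
  calc _ ≤ unifProb (ClassZ c 2 𝓕 𝓗) (fun p => ∃ qa : TreeCode t × (Fin 2 → Fin e → Fin t),
        ∃ x : Fin (t + e) → S, Function.Injective x ∧
        Matches (codePattern qa.1.1 qa.2) (fun σ k => ClassZ.hash p σ (x k).1)) :=
      unifProb_mono fun p ⟨q, a, h⟩ => ⟨(q, a), h⟩
    _ ≤ _ := unifProb_exists_le _
    _ ≤ _ := Finset.sum_le_card_nsmul _ _ _ fun qa _ =>
      unifProb_exists_matches_le h𝓕 h𝓗 hc S hS hm ht _ (isAttaching_codePattern ht qa.1 qa.2)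
    _ ≤ _ := by
      rw [nsmul_eq_mul]
      gcongr
      have h1 := card_treeCode_le t
      rw [Nat.card_eq_fintype_card] at h1
      have h2 : Fintype.card (Fin 2 → Fin e → Fin t) = t ^ (2 * e) := by
        simp [← pow_mul, mul_comm]
      rw [Finset.card_univ, Fintype.card_prod, h2]
      exact_mod_cast Nat.mul_le_mul_right _ h1

end Patterns

/-! ### Breadth first search in a component. -/

section Search

variable {U : Type*} {m : ℕ}

/-- The end point on side `σ` of the edge that belongs to the key `x`. -/
def endpoint (h : Fin 2 → U → Fin m) (σ : Fin 2) (x : U) : Fin m ⊕ Fin m :=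
  if σ = 0 then Sum.inl (h 0 x) else Sum.inr (h 1 x)

theorem endpoint_eq_endpoint {h : Fin 2 → U → Fin m} {σ τ : Fin 2} {x y : U}
    (he : endpoint h σ x = endpoint h τ y) : σ = τ ∧ h σ x = h σ y := by
  fin_cases σ <;> fin_cases τ <;> simp [endpoint] at he ⊢ <;> exact he

theorem isLink_hashGraph_iff {S : Finset U} {h : Fin 2 → U → Fin m} {x : U}
    {v w : Fin m ⊕ Fin m} : (hashGraph S (h 0) (h 1)).IsLink x v w ↔
      x ∈ S ∧ ∃ σ, v = endpoint h σ x ∧ w = endpoint h σ.rev x := by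
  simp [hashGraph, endpoint, Fin.exists_fin_two]

theorem adj_hashGraph_iff {S : Finset U} {h : Fin 2 → U → Fin m} {v w : Fin m ⊕ Fin m} :
    (hashGraph S (h 0) (h 1)).Adj v w ↔
      ∃ x ∈ S, ∃ σ, v = endpoint h σ x ∧ w = endpoint h σ.rev x := by
  simp only [Graph.Adj, isLink_hashGraph_iff]

theorem fin_two_eq_or_eq_rev (σ τ : Fin 2) : σ = τ ∨ σ = τ.rev := by
  revert σ τ; decide

section Component

variable {V E : Type*} {G : Graph V E} {C : Set V}

theorem IsComponent.mem_of_adj (hC : IsComponent G C) {v w : V} (hv : v ∈ C) (h : G.Adj v w) :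
    w ∈ C := by
  obtain ⟨u, -, rfl⟩ := hC
  exact Relation.ReflTransGen.tail hv h

theorem IsComponent.reachable (hC : IsComponent G C) {v w : V} (hv : v ∈ C) (hw : w ∈ C) :
    Relation.ReflTransGen G.Adj v w := by
  obtain ⟨u, -, rfl⟩ := hC
  have hsymm : Std.Symm G.Adj := ⟨fun _ _ h => h.symm⟩
  exact (Std.Symm.symm _ _ hv).trans hw

theorem IsComponent.exists_adj_notMem (hC : IsComponent G C) {X : Set V} {v : V} (hv : v ∈ C)
    (hvX : v ∈ X) (hCX : ¬ C ⊆ X) : ∃ u ∈ X, ∃ w, G.Adj u w ∧ w ∉ X := by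
  by_contra hcon
  push Not at hcon
  refine hCX fun w hw => ?_
  have hr := hC.reachable hv hw
  induction hr with
  | refl => exact hvX
  | tail hab hbc ih =>
    have hb := hC.mem_of_adj hw hbc.symm
    exact hcon _ (ih hb) _ hbc

end Component

/-- The `j`-th vertex found by a search which lists the edges `x`, where `s j` is the side of the
`j`-th vertex. -/
def searchVertex (h : Fin 2 → U → Fin m) (x : ℕ → U) (s : ℕ → Fin 2) (j : ℕ) : Fin m ⊕ Fin m :=
  endpoint h (s j) (x (j - 1))

/-- A breadth first search in the component `C` has listed the edges `x 0, …, x (t - 1)`, where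
`x i` joins the `q i`-th vertex to the new `i + 1`-st vertex. -/
structure IsSearch (S : Finset U) (h : Fin 2 → U → Fin m) (C : Set (Fin m ⊕ Fin m)) (t : ℕ)
    (x : ℕ → U) (q : ℕ → ℕ) (s : ℕ → Fin 2) : Prop where
  mem : ∀ i, i < t → x i ∈ S
  q_le : ∀ i, i < t → q i ≤ i
  mono : ∀ i j, i ≤ j → j < t → q i ≤ q j
  s_zero : s 0 = 0
  s_succ : ∀ i, i < t → s (i + 1) = (s (q i)).rev
  attach : ∀ i, i < t → endpoint h (s (q i)) (x i) = searchVertex h x s (q i)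
  inj : ∀ i j, i ≤ t → j ≤ t → searchVertex h x s i = searchVertex h x s j → i = j
  vertex_mem : ∀ j, j ≤ t → searchVertex h x s j ∈ C
  closed : ∀ j, j < q (t - 1) → ∀ w,
    (hashGraph S (h 0) (h 1)).Adj (searchVertex h x s j) w → ∃ k, k ≤ t ∧ w = searchVertex h x s k

variable {S : Finset U} {h : Fin 2 → U → Fin m} {C : Set (Fin m ⊕ Fin m)}

theorem exists_isSearch_one (hC : IsComponent (hashGraph S (h 0) (h 1)) C) (ht : 2 ≤ C.ncard) :
    ∃ x q s, IsSearch S h C 1 x q s := by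
  obtain ⟨v, hv⟩ : C.Nonempty := Set.nonempty_of_ncard_ne_zero (by omega)
  obtain ⟨u, hu, w, huw, -⟩ := hC.exists_adj_notMem (X := {v}) hv rfl fun hsub => by
    have := Set.ncard_le_ncard hsub
    rw [Set.ncard_singleton] at this
    omega
  rw [Set.mem_singleton_iff] at hu
  subst hu
  have hw := hC.mem_of_adj hv huw
  obtain ⟨y, hy, σ, h1, h2⟩ := adj_hashGraph_iff.mp huw
  have hmem : ∀ τ, endpoint h τ y ∈ C := by
    intro τ
    rcases fin_two_eq_or_eq_rev τ σ with rfl | rfl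
    · exact h1 ▸ hv
    · exact h2 ▸ hw
  -- The root is the left end of an edge in `C`, so its side need not be coded. Vertices 0 and 1 are
  -- both ends of edge 0, consistently with `0 - 1 = 0`.
  refine ⟨fun _ => y, fun _ => 0, fun j => if j = 0 then 0 else 1, ⟨fun _ _ => hy,
    fun _ _ => Nat.zero_le _, fun _ _ _ _ => le_rfl, rfl, fun i hi => ?_, fun i hi => rfl,
    fun i j hi hj hij => ?_, fun j _ => hmem _, fun j hj => absurd hj (Nat.not_lt_zero _)⟩⟩
  · simp only [Nat.add_eq_zero_iff, one_ne_zero, and_false, if_false, if_true]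
    rfl
  · have h3 := (endpoint_eq_endpoint hij).1
    rcases Nat.eq_zero_or_pos i with rfl | hi' <;> rcases Nat.eq_zero_or_pos j with rfl | hj'
    · rfl
    · simp [hj'.ne'] at h3
    · simp [hi'.ne'] at h3
    · omega

theorem IsSearch.exists_succ (hC : IsComponent (hashGraph S (h 0) (h 1)) C) {t : ℕ} (ht : 1 ≤ t)
    {x : ℕ → U} {q : ℕ → ℕ} {s : ℕ → Fin 2} (hs : IsSearch S h C t x q s)
    (hcard : t + 2 ≤ C.ncard) : ∃ x q s, IsSearch S h C (t + 1) x q s := by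
  classical
  let X : Set (Fin m ⊕ Fin m) := {v | ∃ k, k ≤ t ∧ v = searchVertex h x s k}
  have hX : ¬ C ⊆ X := by
    intro hsub
    have hXim : X = ((Finset.range (t + 1)).image (searchVertex h x s) : Set _) := by
      ext v
      simp [X, eq_comm]
    have h1 := Set.ncard_le_ncard hsub
    rw [hXim, Set.ncard_coe_finset] at h1
    have h2 := h1.trans Finset.card_image_le
    rw [Finset.card_range] at h2
    omega
  have hex : ∃ j, j ≤ t ∧ ∃ w, (hashGraph S (h 0) (h 1)).Adj (searchVertex h x s j) w ∧ w ∉ X := by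
    obtain ⟨u, ⟨j, hj, rfl⟩, w, hw, hwX⟩ := hC.exists_adj_notMem (hs.vertex_mem 0 (Nat.zero_le _))
      (X := X) ⟨0, Nat.zero_le _, rfl⟩ hX
    exact ⟨j, hj, w, hw, hwX⟩
  -- Continuing from the least listed vertex with an unlisted neighbour keeps `q` monotone and
  -- preserves `closed`.
  obtain ⟨hj, w, hjw, hwX⟩ := Nat.find_spec hex
  have hmin : ∀ i, i < Nat.find hex → ∀ w,
      (hashGraph S (h 0) (h 1)).Adj (searchVertex h x s i) w → w ∈ X := by
    intro i hi w hw
    by_contra hwX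
    exact Nat.find_min hex hi ⟨by omega, w, hw, hwX⟩
  generalize Nat.find hex = j at *
  have hqj : q (t - 1) ≤ j := by
    by_contra hlt
    exact hwX (hs.closed j (not_le.mp hlt) w hjw)
  have hwC := hC.mem_of_adj (hs.vertex_mem j hj) hjw
  obtain ⟨y, hy, σ, h1, h2⟩ := adj_hashGraph_iff.mp hjw
  obtain rfl : s j = σ := (endpoint_eq_endpoint h1).1
  let x' := Function.update x t y
  let q' := Function.update q t j
  let s' := Function.update s (t + 1) (s j).rev
  have hx' : ∀ i, i < t → x' i = x i := fun i hi => Function.update_of_ne hi.ne _ _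
  have hq' : ∀ i, i < t → q' i = q i := fun i hi => Function.update_of_ne hi.ne _ _
  have hs' : ∀ i, i ≤ t → s' i = s i := fun i hi =>
    Function.update_of_ne (Nat.lt_succ_of_le hi).ne _ _
  have hxt : x' t = y := Function.update_self _ _ _
  have hqt : q' t = j := Function.update_self _ _ _
  have hst : s' (t + 1) = (s j).rev := Function.update_self _ _ _
  have hv : ∀ i, i ≤ t → searchVertex h x' s' i = searchVertex h x s i := by
    intro i hi
    unfold searchVertex
    rw [hs' i hi, hx' (i - 1) (by omega)]
  have hvt : searchVertex h x' s' (t + 1) = w := by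
    unfold searchVertex
    rw [hst, Nat.add_sub_cancel, hxt, h2]
  have hne : ∀ i, i ≤ t → searchVertex h x' s' i ≠ searchVertex h x' s' (t + 1) := by
    intro i hi he
    rw [hv i hi, hvt] at he
    exact hwX ⟨i, hi, he.symm⟩
  refine ⟨x', q', s', ?_, ?_, ?_, ?_, ?_, ?_, ?_, ?_, ?_⟩
  · intro i hi
    rcases Nat.lt_succ_iff_lt_or_eq.mp hi with hi | rfl
    · rw [hx' i hi]; exact hs.mem i hi
    · rw [hxt]; exact hy
  · intro i hi
    rcases Nat.lt_succ_iff_lt_or_eq.mp hi with hi | rfl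
    · rw [hq' i hi]; exact hs.q_le i hi
    · rw [hqt]; exact hj
  · intro i k hik hk
    rcases Nat.lt_succ_iff_lt_or_eq.mp hk with hk | rfl
    · rw [hq' i (by omega), hq' k hk]; exact hs.mono i k hik hk
    · rw [hqt]
      rcases hik.lt_or_eq with hi | rfl
      · rw [hq' i hi]
        exact (hs.mono i (k - 1) (by omega) (by omega)).trans hqj
      · rw [hqt]
  · rw [hs' 0 (Nat.zero_le _)]; exact hs.s_zero
  · intro i hi
    rcases Nat.lt_succ_iff_lt_or_eq.mp hi with hi | rfl
    · have := hs.q_le i hi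
      rw [hs' (i + 1) hi, hq' i hi, hs' (q i) (by omega)]
      exact hs.s_succ i hi
    · rw [hst, hqt, hs' j hj]
  · intro i hi
    rcases Nat.lt_succ_iff_lt_or_eq.mp hi with hi | rfl
    · have := hs.q_le i hi
      rw [hq' i hi, hs' (q i) (by omega), hx' i hi, hv (q i) (by omega)]
      exact hs.attach i hi
    · rw [hqt, hxt, hs' j hj, hv j hj, ← h1]
  · intro i k hi hk hik
    rcases hi.lt_or_eq with hi | rfl <;> rcases hk.lt_or_eq with hk | rfl
    · rw [hv i (by omega), hv k (by omega)] at hik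
      exact hs.inj i k (by omega) (by omega) hik
    · exact absurd hik (hne i (by omega))
    · exact absurd hik.symm (hne k (by omega))
    · rfl
  · intro i hi
    rcases hi.lt_or_eq with hi | rfl
    · rw [hv i (by omega)]; exact hs.vertex_mem i (by omega)
    · rw [hvt]; exact hwC
  · intro i hi v hiv
    rw [Nat.add_sub_cancel, hqt] at hi
    rw [hv i (by omega)] at hiv
    obtain ⟨k, hk, rfl⟩ := hmin i hi v hiv
    exact ⟨k, by omega, (hv k hk).symm⟩

theorem exists_isSearch (hC : IsComponent (hashGraph S (h 0) (h 1)) C) {t : ℕ} (ht : 1 ≤ t)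
    (hcard : t + 1 ≤ C.ncard) : ∃ x q s, IsSearch S h C t x q s := by
  induction t, ht using Nat.le_induction with
  | base => exact exists_isSearch_one hC hcard
  | succ t ht ih =>
    obtain ⟨x, q, s, hs⟩ := ih (by omega)
    exact hs.exists_succ hC ht hcard

/-- The ends of edge `i` are the vertices `q i` and `i + 1`, so a later edge, which reaches a new
vertex, cannot repeat it. -/
theorem IsSearch.edge_injective {t : ℕ} {x : ℕ → U} {q : ℕ → ℕ} {s : ℕ → Fin 2}
    (hs : IsSearch S h C t x q s) {i k : ℕ} (hi : i < t) (hk : k < t) (hik : x i = x k) :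
    i = k := by
  have key : ∀ i k, i < k → k < t → x i ≠ x k := by
    intro i k hik hk he
    have hi := hik.trans hk
    have hqi := hs.q_le i hi
    have hv : searchVertex h x s (k + 1) = endpoint h (s (k + 1)) (x i) := by
      rw [he]; rfl
    rcases fin_two_eq_or_eq_rev (s (k + 1)) (s (q i)) with h1 | h1
    · rw [h1, hs.attach i hi] at hv
      have := hs.inj _ _ (by omega) (by omega) hv
      omega
    · rw [h1, ← hs.s_succ i hi] at hv
      have := hs.inj (k + 1) (i + 1) (by omega) (by omega) hv
      omega
  rcases lt_trichotomy i k with hlt | rfl | hlt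
  · exact absurd hik (key i k hlt hk)
  · rfl
  · exact absurd hik.symm (key k i hlt hi)

theorem IsSearch.side_eq {t : ℕ} {x : ℕ → U} {q : ℕ → ℕ} {s : ℕ → Fin 2}
    (hs : IsSearch S h C t x q s) {q' : ℕ → ℕ} (hq : ∀ i, i < t → q' i = q i) (j : ℕ)
    (hj : j ≤ t) : side q' j = s j := by
  induction j using Nat.strong_induction_on with
  | _ j ih =>
    rcases j with _ | j
    · rw [side, hs.s_zero]
    · have hqj := hs.q_le j hj
      -- The `min` in `side` only secures termination; it is inactive since `q j ≤ j`.
      rw [side, hq j hj, min_eq_left hqj, ih (q j) (by omega) (by omega), hs.s_succ j hj]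

theorem IsSearch.hasTree {t : ℕ} {x : ℕ → U} {q : ℕ → ℕ} {s : ℕ → Fin 2}
    (hs : IsSearch S h C t x q s) {e : ℕ} (y : Fin e → U) (hyS : ∀ i, y i ∈ S)
    (hy : Function.Injective y) (hyx : ∀ i k, k < t → y i ≠ x k) (a : Fin 2 → Fin e → Fin t)
    (ha : ∀ σ i, h σ (y i) = h σ (x (a σ i))) : HasTree S h t e := by
  let q₀ : Fin t → Fin t := fun i => ⟨q i, (hs.q_le i i.2).trans_lt i.2⟩
  let z : Fin (t + e) → S := fun k => if hk : k.1 < t then ⟨x k, hs.mem k hk⟩ else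
    ⟨y ⟨k - t, by omega⟩, hyS _⟩
  have hz₁ : ∀ k (hk : k.1 < t), (z k).1 = x k := fun k hk => by simp only [z, dif_pos hk]
  have hz₂ : ∀ k (hk : ¬ k.1 < t), (z k).1 = y ⟨k - t, by omega⟩ := fun k hk => by
    simp only [z, dif_neg hk]
  refine ⟨⟨q₀, fun i k hik => hs.mono i k hik k.2, fun i => hs.q_le i i.2⟩, a, z, ?_, ?_⟩
  · intro i k hik
    have hik' : (z i).1 = (z k).1 := congrArg _ hik
    by_cases hi : i.1 < t <;> by_cases hk : k.1 < t
    · rw [hz₁ i hi, hz₁ k hk] at hik'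
      exact Fin.ext (hs.edge_injective hi hk hik')
    · rw [hz₁ i hi, hz₂ k hk] at hik'
      exact absurd hik'.symm (hyx _ _ hi)
    · rw [hz₂ i hi, hz₁ k hk] at hik'
      exact absurd hik' (hyx _ _ hk)
    · rw [hz₂ i hi, hz₂ k hk] at hik'
      have := congrArg Fin.val (hy hik')
      simp only at this
      exact Fin.ext (by omega)
  · intro σ i b hib
    simp only
    unfold codePattern at hib
    by_cases hi : i.1 < t
    · rw [dif_pos hi] at hib
      have hqi := hs.q_le i hi
      rw [hs.side_eq (fun k hk => by simp [q₀, hk]) _ (by simp only [q₀]; omega)] at hib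
      split_ifs at hib with hσ
      · simp only [q₀] at hib hσ
        have hat := (endpoint_eq_endpoint (hs.attach i hi)).2
        rw [hz₁ i hi, hz₁ b (by omega), ← hib, hσ]
        exact hat
      · rw [Fin.ext hib]
    · rw [dif_neg hi, dif_pos (by omega)] at hib
      rw [hz₂ i hi, hz₁ b (by have := (a σ ⟨i - t, by omega⟩).2; omega), ha, hib]

theorem hasTree_of_le_ncard (hC : IsComponent (hashGraph S (h 0) (h 1)) C) {t : ℕ} (ht : 1 ≤ t)
    (hcard : t + 1 ≤ C.ncard) : HasTree S h t 0 := by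
  obtain ⟨x, q, s, hs⟩ := exists_isSearch hC ht hcard
  exact hs.hasTree (fun i => i.elim0) (fun i => i.elim0) (fun i => i.elim0) (fun i => i.elim0)
    (fun _ i => i.elim0) (fun _ i => i.elim0)

theorem mem_componentEdges (hC : IsComponent (hashGraph S (h 0) (h 1)) C) {y : U}
    (hy : y ∈ componentEdges (hashGraph S (h 0) (h 1)) C) : y ∈ S ∧ ∀ σ, endpoint h σ y ∈ C := by
  obtain ⟨v, hv, w, hvw⟩ := hy
  have hw := hC.mem_of_adj hv ⟨y, hvw⟩
  obtain ⟨hyS, σ, rfl, rfl⟩ := isLink_hashGraph_iff.mp hvw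
  refine ⟨hyS, fun τ => ?_⟩
  rcases fin_two_eq_or_eq_rev τ σ with rfl | rfl
  · exact hv
  · exact hw

theorem hasTree_of_dense (hC : IsComponent (hashGraph S (h 0) (h 1)) C) {e : ℕ} (he : 1 ≤ e)
    (hd : C.ncard + e - 1 ≤ (componentEdges (hashGraph S (h 0) (h 1)) C).ncard) :
    ∃ t, 1 ≤ t ∧ t + 1 = C.ncard ∧ HasTree S h t e := by
  classical
  have hC0 : 0 < C.ncard := by
    obtain ⟨v, -, hv⟩ := hC
    rw [Set.ncard_pos]
    exact ⟨v, hv ▸ Relation.ReflTransGen.refl⟩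
  have hC2 : 2 ≤ C.ncard := by
    obtain ⟨y, hy⟩ : (componentEdges (hashGraph S (h 0) (h 1)) C).Nonempty :=
      Set.nonempty_of_ncard_ne_zero (by omega)
    have hm := (mem_componentEdges hC hy).2
    exact (Set.one_lt_ncard_iff).mpr ⟨_, _, hm 0, hm 1, by simp [endpoint]⟩
  obtain ⟨t, ht⟩ : ∃ t, t + 1 = C.ncard := ⟨C.ncard - 1, by omega⟩
  have ht1 : 1 ≤ t := by omega
  refine ⟨t, ht1, ht, ?_⟩
  obtain ⟨x, q, s, hs⟩ := exists_isSearch hC ht1 ht.le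
  -- The search lists `t + 1` distinct vertices of `C`, hence all of `C`, so every other edge of the
  -- component has both ends in the tree.
  have hcover : ∀ v ∈ C, ∃ k, k ≤ t ∧ searchVertex h x s k = v := by
    have hsub : (((Finset.range (t + 1)).image (searchVertex h x s) : Finset _) : Set _) ⊆ C := by
      intro v hv
      simp only [Finset.coe_image, Set.mem_image, Finset.mem_coe, Finset.mem_range] at hv
      obtain ⟨k, hk, rfl⟩ := hv
      exact hs.vertex_mem k (by omega)
    have heq := Set.eq_of_subset_of_ncard_le hsub (by
      rw [Set.ncard_coe_finset, Finset.card_image_of_injOn, Finset.card_range, ht]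
      intro i hi k hk hik
      simp only [Finset.coe_range, Set.mem_Iio] at hi hk
      exact hs.inj i k (by omega) (by omega) hik)
    intro v hv
    rw [← heq] at hv
    simp only [Finset.coe_image, Set.mem_image, Finset.mem_coe, Finset.mem_range] at hv
    obtain ⟨k, hk, hkv⟩ := hv
    exact ⟨k, by omega, hkv⟩
  let T : Finset U := (Finset.range t).image x
  let D : Finset U := {y ∈ S | y ∈ componentEdges (hashGraph S (h 0) (h 1)) C}
  have hD : (D : Set U) = componentEdges (hashGraph S (h 0) (h 1)) C := by
    ext y
    simp only [D, Finset.coe_filter, Set.mem_ofPred_eq, and_iff_right_iff_imp]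
    exact fun hy => (mem_componentEdges hC hy).1
  -- The component has at least `t + e` edges, of which the tree uses at most `t`.
  have hcard : e ≤ (D \ T).card := by
    rw [← hD, Set.ncard_coe_finset] at hd
    have h1 : T.card ≤ t := Finset.card_image_le.trans (Finset.card_range t).le
    have h2 := Finset.le_card_sdiff T D
    omega
  obtain ⟨D', hD', hcard'⟩ := Finset.exists_subset_card_eq hcard
  let y : Fin e → U := fun i => (D'.equivFinOfCardEq hcard').symm i
  have hyD : ∀ i, y i ∈ D \ T := fun i => hD' (Subtype.prop _)
  have hyE : ∀ i, y i ∈ componentEdges (hashGraph S (h 0) (h 1)) C := fun i =>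
    (Finset.mem_filter.mp (Finset.mem_sdiff.mp (hyD i)).1).2
  have hend : ∀ σ i, ∃ a : Fin t, h σ (y i) = h σ (x a) := by
    intro σ i
    obtain ⟨k, hk, hkv⟩ := hcover _ ((mem_componentEdges hC (hyE i)).2 σ)
    have := endpoint_eq_endpoint hkv.symm
    exact ⟨⟨k - 1, by omega⟩, this.2⟩
  choose a ha using hend
  refine hs.hasTree y (fun i => (mem_componentEdges hC (hyE i)).1)
    (Subtype.val_injective.comp (Equiv.injective _)) (fun i k hk hik => ?_) a ha
  exact (Finset.mem_sdiff.mp (hyD i)).2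
    (Finset.mem_image.mpr ⟨k, Finset.mem_range.mpr hk, hik.symm⟩)

end Search

/-! ### Numerical estimates. -/

section Bounds

/-- The contribution of the sequences of keys on which the hash functions are not random. -/
theorem collision_term_le {y W K₀ n ℓ : ℝ} {t e s b a : ℕ} (hy : 1 ≤ y) (hW : 1 ≤ W)
    (hWy : W ≤ K₀ * y) (hte : ((t + e : ℕ) : ℝ) ≤ W) (hes : e ≤ s) (ht4 : (4 : ℝ) ^ t ≤ y ^ (16 * b))
    (hn : n = y ^ 8) (hℓ : y ^ 4 ≤ ℓ) :
    W * (4 ^ t * (t : ℝ) ^ (2 * e) * (((t + e : ℕ) : ℝ) *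
      (n * (2 * ((t + e : ℕ) : ℝ) ^ 2 / ℓ) ^ (8 * b + s + 5 + 4 * a)))) ≤
      K₀ ^ (2 * s + 2) * (2 * K₀ ^ 2) ^ (8 * b + s + 5 + 4 * a) * (y ^ (8 * a))⁻¹ := by
  have hy0 : 0 < y := by linarith
  have hW0 : 0 < W := by linarith
  have hℓ0 : 0 < ℓ := lt_of_lt_of_le (by positivity) hℓ
  have htW : (t : ℝ) ≤ W := le_trans (by push_cast; linarith [(Nat.cast_nonneg e : (0 : ℝ) ≤ e)]) hte
  have hpow : (t : ℝ) ^ (2 * e) ≤ W ^ (2 * s) :=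
    (pow_le_pow_left₀ (by positivity) htW _).trans (pow_le_pow_right₀ hW (by omega))
  have hK0 : 0 < K₀ := by
    by_contra hneg
    have := mul_nonpos_of_nonpos_of_nonneg (not_lt.mp hneg) hy0.le
    linarith
  subst hn
  calc _ ≤ (K₀ * y) * (y ^ (16 * b) * (K₀ * y) ^ (2 * s) * ((K₀ * y) *
        (y ^ 8 * (2 * (K₀ * y) ^ 2 / y ^ 4) ^ (8 * b + s + 5 + 4 * a)))) := by
        have h1 : (t : ℝ) ^ (2 * e) ≤ (K₀ * y) ^ (2 * s) :=
          hpow.trans (pow_le_pow_left₀ hW0.le hWy _)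
        have h2 : ((t + e : ℕ) : ℝ) ≤ K₀ * y := hte.trans hWy
        gcongr
    _ = K₀ ^ (2 * s + 2) * (2 * K₀ ^ 2) ^ (8 * b + s + 5 + 4 * a) *
        (y ^ (16 * b + 2 * s + 10) * ((y ^ 2)⁻¹) ^ (8 * b + s + 5 + 4 * a)) := by
        have h1 : 2 * (K₀ * y) ^ 2 / y ^ 4 = 2 * K₀ ^ 2 * (y ^ 2)⁻¹ := by field_simp
        rw [h1, mul_pow (2 * K₀ ^ 2), mul_pow K₀]
        ring
    -- The exponent `8 * b + s + 5 + 4 * a` is chosen so that its double exceeds the accumulated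
    -- power of `y` by exactly `8 * a`.
    _ = _ := by
        congr 1
        rw [inv_pow, ← pow_mul, show 2 * (8 * b + s + 5 + 4 * a) =
          (16 * b + 2 * s + 10) + 8 * a by ring, pow_add y (16 * b + 2 * s + 10) (8 * a), mul_inv,
          ← mul_assoc, mul_inv_cancel₀ (by positivity), one_mul]

/-- The contribution of the sequences of keys on which the hash functions are random, for trees
with additional edges. -/
theorem excess_term_le {y W K₀ n : ℝ} {t a : ℕ} (hy : 1 ≤ y) (hW : 1 ≤ W)
    (hWy : W ≤ K₀ * y) (htW : (t : ℝ) ≤ W) (hn : n = y ^ 8) :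
    W * (4 ^ t * (t : ℝ) ^ (2 * (2 * a + 2)) *
      (6 * n * (1 / 6 : ℝ) ^ t * (1 / n) ^ (2 * a + 2))) ≤
      6 * K₀ ^ (4 * a + 5) * (y ^ (8 * a))⁻¹ := by
  have hy0 : 0 < y := by linarith
  have hK0 : 0 < K₀ := by
    by_contra hneg
    have := mul_nonpos_of_nonpos_of_nonneg (not_lt.mp hneg) hy0.le
    linarith
  have h46 : (4 : ℝ) ^ t * (1 / 6) ^ t ≤ 1 := by
    rw [← mul_pow]; exact pow_le_one₀ (by norm_num) (by norm_num)
  have htK : (t : ℝ) ≤ K₀ * y := htW.trans hWy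
  subst hn
  calc _ = W * ((4 ^ t * (1 / 6) ^ t) * (t : ℝ) ^ (2 * (2 * a + 2)) *
        (6 * y ^ 8 * (1 / y ^ 8) ^ (2 * a + 2))) := by ring
    _ ≤ (K₀ * y) * (1 * (K₀ * y) ^ (2 * (2 * a + 2)) *
        (6 * y ^ 8 * (1 / y ^ 8) ^ (2 * a + 2))) := by gcongr
    _ = 6 * K₀ ^ (4 * a + 5) * (y ^ (4 * a + 13) * (y ^ (16 * a + 16))⁻¹) := by
        rw [one_div, inv_pow, ← pow_mul, show 8 * (2 * a + 2) = 16 * a + 16 by ring]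
        ring
    _ ≤ 6 * K₀ ^ (4 * a + 5) * (y ^ (8 * a))⁻¹ := by
        gcongr
        rw [← div_eq_mul_inv, div_le_iff₀ (by positivity), inv_mul_eq_div,
          le_div_iff₀ (by positivity), ← pow_add]
        exact pow_le_pow_right₀ hy (by omega)

theorem four_pow_le_of_le_log {n : ℝ} (hn : 1 ≤ n) {t b : ℕ} (ht : (t : ℝ) ≤ b * Real.log n) :
    (4 : ℝ) ^ t ≤ n ^ (2 * b) := by
  have h4 : Real.log 4 ≤ 2 := by
    have h1 : (4 : ℝ) = 2 ^ 2 := by norm_num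
    rw [h1, Real.log_pow]
    have := Real.log_le_sub_one_of_pos (show (0 : ℝ) < 2 by norm_num)
    push_cast
    linarith
  rw [← Real.log_le_log_iff (by positivity) (by positivity), Real.log_pow, Real.log_pow]
  push_cast
  calc (t : ℝ) * Real.log 4 ≤ t * 2 := by gcongr
    _ ≤ _ := by linarith

theorem two_thirds_pow_le {n : ℝ} (hn : 1 ≤ n) {t a : ℕ}
    (ht : (3 * (a + 1) : ℝ) * Real.log n ≤ t + 1) :
    n * (2 / 3 : ℝ) ^ t ≤ 3 / 2 * (n ^ a)⁻¹ := by
  have h3 : 1 / 3 ≤ Real.log (3 / 2) := by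
    have := Real.one_sub_inv_le_log_of_pos (show (0 : ℝ) < 3 / 2 by norm_num)
    linarith
  have hlog := Real.log_nonneg hn
  have key : n ^ (a + 1) ≤ (3 / 2 : ℝ) ^ (t + 1) := by
    rw [← Real.log_le_log_iff (by positivity) (by positivity), Real.log_pow, Real.log_pow]
    push_cast
    calc ((a : ℝ) + 1) * Real.log n ≤ (t + 1) * (1 / 3) := by linarith
      _ ≤ _ := by gcongr
  have h23 : (2 / 3 : ℝ) ^ t = 3 / 2 * ((3 / 2 : ℝ) ^ (t + 1))⁻¹ := by
    rw [pow_succ, mul_inv, ← inv_pow]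
    norm_num
    ring
  rw [h23]
  have hn0 : 0 < n := by linarith
  calc n * (3 / 2 * ((3 / 2 : ℝ) ^ (t + 1))⁻¹) ≤ n * (3 / 2 * (n ^ (a + 1))⁻¹) := by gcongr
    _ = _ := by
      rw [pow_succ]
      field_simp

theorem log_le_eight_mul {n y : ℝ} (hy : 0 < y) (hn : n = y ^ 8) : Real.log n ≤ 8 * y := by
  rw [hn, Real.log_pow]
  push_cast
  have := Real.log_le_sub_one_of_pos hy
  linarith

end Bounds

/-! ### From trees to components. -/

section Components

variable {U : Type*} {m : ℕ}

theorem hasTree_of_hasLargeComponent {S : Finset U} {h : Fin 2 → U → Fin m} {b : ℝ} {t : ℕ}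
    (ht : 1 ≤ t) (htb : (t : ℝ) < b) (hL : HasLargeComponent (hashGraph S (h 0) (h 1)) b) :
    HasTree S h t 0 := by
  obtain ⟨C, hC, hb⟩ := hL
  exact hasTree_of_le_ncard hC ht (by exact_mod_cast htb.trans_le hb)

/-- Large components are split off so that only tree sizes up to `b` enter the union bound. -/
theorem hasTree_of_hasDenseComponent {S : Finset U} {h : Fin 2 → U → Fin m} {b : ℝ} {s : ℕ}
    (hs : 1 ≤ s) (hD : HasDenseComponent (hashGraph S (h 0) (h 1)) s) :
    HasLargeComponent (hashGraph S (h 0) (h 1)) b ∨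
      ∃ i : Fin ⌊b⌋₊, HasTree S h (i + 1) s := by
  obtain ⟨C, k, hC, rfl, hd⟩ := hD
  by_cases hb : b ≤ (C.ncard : ℝ)
  · exact Or.inl ⟨C, hC, hb⟩
  · obtain ⟨t, ht, htC, hT⟩ := hasTree_of_dense hC hs hd
    rw [← htC] at hb
    have htb : t ≤ ⌊b⌋₊ := Nat.le_floor (by push_cast at hb; linarith)
    refine Or.inr ⟨⟨t - 1, by omega⟩, ?_⟩
    simpa only [Nat.sub_add_cancel ht] using hT

theorem unifProb_component_le {a : ℕ} {n ℓ : ℕ} {S : Finset U} (hS : S.card = n) (hn : 2 ≤ n)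
    (hm : 6 * n ≤ m) (hℓ : ℓ = ⌈(n : ℝ) ^ (1 / 2 : ℝ)⌉₊) {b s c : ℕ} (hb : b = 3 * (a + 1))
    (hs : s = 2 * a + 2) (hc : c = 8 * b + s + 5 + 4 * a) {𝓕 : HashClass U ℓ} {𝓗 : HashClass U m}
    (h𝓕 : IsUniversal 2 𝓕) (h𝓗 : IsWiseIndependent 2 𝓗) {K₀ K₁ : ℝ} (hK₀ : K₀ = 8 * b + s)
    (hK₁ : K₁ = K₀ ^ (2 * s + 2) * (2 * K₀ ^ 2) ^ c) :
    unifProb (ClassZ c 2 𝓕 𝓗) (fun p => HasLargeComponent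
        (hashGraph S (p.hash 0) (p.hash 1)) ((b : ℝ) * Real.log n)) ≤
      (9 + K₁) * ((n : ℝ) ^ a)⁻¹ ∧
    unifProb (ClassZ c 2 𝓕 𝓗) (fun p => HasDenseComponent
        (hashGraph S (p.hash 0) (p.hash 1)) s) ≤
      (9 + K₁ + (6 * K₀ ^ (4 * a + 5) + K₁)) * ((n : ℝ) ^ a)⁻¹ := by
  have hn2 : (2 : ℝ) ≤ n := by exact_mod_cast hn
  have hn0 : (0 : ℝ) < n := by linarith
  -- With `y = n ^ (1 / 8)`, all quantities compare with integer powers of `y`: `n = y ^ 8`, `ℓ ≥ y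
  -- ^ 4`, and `log n ≤ 8 * y`.
  obtain ⟨y, hy⟩ : ∃ y : ℝ, y = (n : ℝ) ^ (1 / 8 : ℝ) := ⟨_, rfl⟩
  have hy1 : 1 ≤ y := hy ▸ Real.one_le_rpow (by linarith) (by norm_num)
  have hny : (n : ℝ) = y ^ 8 := by
    rw [hy, ← Real.rpow_natCast, ← Real.rpow_mul hn0.le]; norm_num
  have hℓy : y ^ 4 ≤ (ℓ : ℝ) := by
    rw [hℓ]
    refine le_trans (le_of_eq ?_) (Nat.le_ceil _)
    rw [hy, ← Real.rpow_natCast, ← Real.rpow_mul hn0.le]; norm_num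
  have hna : (n : ℝ) ^ a = y ^ (8 * a) := by rw [hny, ← pow_mul]
  obtain ⟨B, hB⟩ : ∃ B : ℝ, B = (b : ℝ) * Real.log n := ⟨_, rfl⟩
  have hb6 : (3 : ℝ) ≤ b := by rw [hb]; push_cast; linarith [(Nat.cast_nonneg a : (0 : ℝ) ≤ a)]
  have hlog : 1 / 2 ≤ Real.log n := by
    have := Real.one_sub_inv_le_log_of_pos hn0
    have h2 : (n : ℝ)⁻¹ ≤ 2⁻¹ := inv_anti₀ (by norm_num) hn2
    linarith
  have hB1 : 1 < B := by rw [hB]; nlinarith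
  have hs1 : (1 : ℝ) ≤ s := by rw [hs]; push_cast; linarith [(Nat.cast_nonneg a : (0 : ℝ) ≤ a)]
  have hW : 1 ≤ B + s := by linarith
  have hWy : B + s ≤ K₀ * y := by
    have h1 := log_le_eight_mul (by linarith) hny
    calc B + s ≤ b * (8 * y) + s * y := by
          rw [hB]
          gcongr
          exact le_mul_of_one_le_right (by linarith) hy1
      _ = _ := by rw [hK₀]; ring
  have h4 : ∀ t : ℕ, (t : ℝ) ≤ B → (4 : ℝ) ^ t ≤ y ^ (16 * b) := by
    intro t ht
    refine (four_pow_le_of_le_log (by linarith) (ht.trans hB.le)).trans (le_of_eq ?_)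
    rw [hny, ← pow_mul]
    congr 1
    ring
  have hcoll : ∀ t e : ℕ, (t : ℝ) ≤ B → e ≤ s → (B + s) * (4 ^ t * (t : ℝ) ^ (2 * e) *
      (((t + e : ℕ) : ℝ) * (n * (2 * ((t + e : ℕ) : ℝ) ^ 2 / ℓ) ^ c))) ≤
      K₁ * ((n : ℝ) ^ a)⁻¹ := by
    intro t e ht he
    have hes : (e : ℝ) ≤ s := by exact_mod_cast he
    rw [hK₁, hna, hc]
    exact collision_term_le hy1 hW hWy (by push_cast; linarith) he (h4 t ht) hny hℓy
  have hc1 : 1 ≤ c := by omega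
  have hlarge : unifProb (ClassZ c 2 𝓕 𝓗) (fun p => HasLargeComponent
        (hashGraph S (p.hash 0) (p.hash 1)) B) ≤ (9 + K₁) * ((n : ℝ) ^ a)⁻¹ := by
    obtain ⟨t, ht⟩ : ∃ t : ℕ, t + 1 = ⌈B⌉₊ :=
      ⟨⌈B⌉₊ - 1, Nat.sub_add_cancel (Nat.ceil_pos.mpr (by linarith))⟩
    have htB : (t : ℝ) < B := Nat.lt_ceil.mp (by omega)
    have hBt : B ≤ t + 1 := by
      have := Nat.le_ceil B
      rw [← ht] at this
      exact_mod_cast this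
    have ht1 : 1 ≤ t := by
      have : (0 : ℝ) < t := by linarith
      exact_mod_cast this
    calc _ ≤ _ := unifProb_mono fun p hp => hasTree_of_hasLargeComponent ht1 htB hp
      _ ≤ _ := unifProb_hasTree_le h𝓕 h𝓗 hc1 S (by omega) (by omega) ht1 0
      _ = 6 * (n * (2 / 3 : ℝ) ^ t) + 4 ^ t * (t : ℝ) ^ (2 * 0) *
        (((t + 0 : ℕ) : ℝ) * (n * (2 * ((t + 0 : ℕ) : ℝ) ^ 2 / ℓ) ^ c)) := by
        rw [hS, show (2 / 3 : ℝ) = 4 * (1 / 6) by norm_num, mul_pow]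
        ring
      _ ≤ 6 * (3 / 2 * ((n : ℝ) ^ a)⁻¹) + K₁ * ((n : ℝ) ^ a)⁻¹ := by
        refine add_le_add (mul_le_mul_of_nonneg_left ?_ (by norm_num)) ?_
        · refine two_thirds_pow_le (by linarith) (le_trans (le_of_eq ?_) hBt)
          rw [hB, hb]
          push_cast
          ring
        · exact (le_mul_of_one_le_left (by positivity) hW).trans
            (hcoll t 0 htB.le (Nat.zero_le _))
      _ = _ := by ring
  refine ⟨hB ▸ hlarge, ?_⟩
  -- Dividing by `B + s` compensates for summing over at most `B` tree sizes.
  have hterm : ∀ i : Fin ⌊B⌋₊, unifProb (ClassZ c 2 𝓕 𝓗)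
      (fun p => HasTree S (ClassZ.hash p) (i + 1) s) ≤
      (6 * K₀ ^ (4 * a + 5) + K₁) * ((n : ℝ) ^ a)⁻¹ / (B + s) := by
    intro i
    obtain ⟨t, ht⟩ : ∃ t, t = (i : ℕ) + 1 := ⟨_, rfl⟩
    have htB : (t : ℝ) ≤ B := by
      have h1 : t ≤ ⌊B⌋₊ := by omega
      exact (Nat.le_floor_iff (by linarith)).mp h1
    rw [← ht]
    refine (unifProb_hasTree_le h𝓕 h𝓗 hc1 S (by omega) (by omega) (by omega) s).trans ?_
    rw [le_div_iff₀ (by linarith), mul_comm, hS, mul_add, mul_add,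
      add_mul (6 * _)]
    refine add_le_add ?_ (hcoll t s htB le_rfl)
    rw [hs, hna]
    rw [hs] at hW hWy
    exact excess_term_le hy1 hW hWy (by push_cast; push_cast at hW; linarith) hny
  have hK : 0 ≤ (6 * K₀ ^ (4 * a + 5) + K₁) * ((n : ℝ) ^ a)⁻¹ := by
    have : 0 ≤ K₀ := by rw [hK₀]; positivity
    rw [hK₁]
    positivity
  calc _ ≤ _ := unifProb_mono fun p hp => hasTree_of_hasDenseComponent (b := B) (by omega) hp
    _ ≤ (9 + K₁) * ((n : ℝ) ^ a)⁻¹ + ∑ _i : Fin ⌊B⌋₊,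
        (6 * K₀ ^ (4 * a + 5) + K₁) * ((n : ℝ) ^ a)⁻¹ / (B + s) :=
      (unifProb_or_le _ _).trans (add_le_add hlarge
        ((unifProb_exists_le _).trans (Finset.sum_le_sum fun i _ => hterm i)))
    _ ≤ (9 + K₁) * ((n : ℝ) ^ a)⁻¹ + (6 * K₀ ^ (4 * a + 5) + K₁) * ((n : ℝ) ^ a)⁻¹ := by
      gcongr
      rw [Finset.sum_const, Finset.card_univ, Fintype.card_fin, nsmul_eq_mul, mul_div_assoc',
        div_le_iff₀ (by linarith), mul_comm]
      gcongr
      have := Nat.floor_le (show 0 ≤ B by linarith)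
      linarith
    _ = _ := by ring

end Components

end HashZ

theorem mainTheorem7 (α : ℝ) (hα : 1 ≤ α) :
    ∃ (β : ℝ) (δ : ℝ) (c s : ℕ), 1 ≤ β ∧ 0 < δ ∧ δ < 1 ∧ 1 ≤ c ∧ 1 ≤ s ∧
      ∃ K : ℝ, 0 < K ∧
        ∀ (U : Type*) [Finite U] (n m ℓ : ℕ) (S : Finset U),
          1 ≤ n → S.card = n → 6 * n ≤ m → ℓ = ⌈(n : ℝ) ^ δ⌉₊ →
          ∀ (𝓕 : HashZ.HashClass U ℓ) (𝓗 : HashZ.HashClass U m),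
            𝓕.Nonempty → 𝓗.Nonempty →
            HashZ.IsUniversal 2 𝓕 → HashZ.IsWiseIndependent 2 𝓗 →
            HashZ.unifProb (HashZ.ClassZ c 2 𝓕 𝓗)
                (fun p => HashZ.HasLargeComponent
                  (HashZ.hashGraph S (HashZ.ClassZ.hash p 0) (HashZ.ClassZ.hash p 1))
                  (β * Real.log n)) ≤ K * (n : ℝ) ^ (-α) ∧
            HashZ.unifProb (HashZ.ClassZ c 2 𝓕 𝓗)
                (fun p => HashZ.HasDenseComponent
                  (HashZ.hashGraph S (HashZ.ClassZ.hash p 0) (HashZ.ClassZ.hash p 1))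
                  s) ≤ K * (n : ℝ) ^ (-α) := by
  obtain ⟨a, ha⟩ : ∃ a : ℕ, a = ⌈α⌉₊ := ⟨_, rfl⟩
  -- The factor 3 in `b` comes from `log (3 / 2) ≥ 1 / 3`. The choice of `s` makes the gain `n ^
  -- (-s)` beat `n` and the powers of `log n`.
  obtain ⟨b, hb⟩ : ∃ b : ℕ, b = 3 * (a + 1) := ⟨_, rfl⟩
  obtain ⟨s, hs⟩ : ∃ s : ℕ, s = 2 * a + 2 := ⟨_, rfl⟩
  obtain ⟨c, hc⟩ : ∃ c : ℕ, c = 8 * b + s + 5 + 4 * a := ⟨_, rfl⟩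
  obtain ⟨K₀, hK₀⟩ : ∃ K₀ : ℝ, K₀ = 8 * b + s := ⟨_, rfl⟩
  obtain ⟨K₁, hK₁⟩ : ∃ K₁ : ℝ, K₁ = K₀ ^ (2 * s + 2) * (2 * K₀ ^ 2) ^ c := ⟨_, rfl⟩
  have hK₀' : 0 ≤ K₀ := by rw [hK₀]; positivity
  have hK₁' : 0 ≤ K₁ := by rw [hK₁]; positivity
  have hK₂ : 0 ≤ 6 * K₀ ^ (4 * a + 5) := by positivity
  refine ⟨b, 1 / 2, c, s, ?_, by norm_num, by norm_num, by omega, by omega,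
    9 + K₁ + (6 * K₀ ^ (4 * a + 5) + K₁), by positivity, ?_⟩
  · exact_mod_cast (show 1 ≤ b by omega)
  intro U _ n m ℓ S hn hS hm hℓ 𝓕 𝓗 _ _ h𝓕 h𝓗
  rcases hn.eq_or_lt with rfl | hn2
  -- For `n = 1` the logarithm vanishes, but the bound is trivial because the constant is at least
  -- 9.
  · simp only [Nat.cast_one, Real.one_rpow, mul_one]
    exact ⟨(HashZ.unifProb_le_one _).trans (by linarith),
      (HashZ.unifProb_le_one _).trans (by linarith)⟩
  · have hn1 : (1 : ℝ) ≤ n := by exact_mod_cast hn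
    have hna : ((n : ℝ) ^ a)⁻¹ ≤ (n : ℝ) ^ (-α) := by
      rw [← Real.rpow_natCast, ← Real.rpow_neg (by linarith)]
      apply Real.rpow_le_rpow_of_exponent_le hn1
      have := Nat.le_ceil α
      rw [← ha] at this
      linarith
    obtain ⟨h1, h2⟩ := HashZ.unifProb_component_le hS hn2 hm hℓ hb hs hc h𝓕 h𝓗 hK₀ hK₁
    constructor
    · refine h1.trans (mul_le_mul (by linarith) hna (by positivity) (by positivity))
    · exact h2.trans (by gcongr)
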